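/- Let $A\to M$ be a Lie algebroid over a (finite-dimensional, Hausdorff, second countable, boundaryless) smooth manifold $M$, i.e. a smooth real vector bundle of finite rank with a Lie algebra structure $[\cdot,\cdot]$ on its space $\Gamma(A)$ of smooth sections and a smooth bundle map $\rho:A\to TM$ (the anchor) such that $\rho([S,T])=[\rho(S),\rho(T)]$ and $[S,fT]=f[S,T]+(\rho(S)\cdot f)\,T$ for $S,T\in\Gamma(A)$, $f\in C^\infty(M)$. Let $(\omega,J,g)$ be a compatible triple on $A$: $\omega$ is a symplectic form on $A$ (a smooth nondegenerate $2$-form on $A$ with $d^A\omega=0$, where $d^A\omega(S,T,U)=\rho(S)\cdot\omega(T,U)-\rho(T)\cdot\omega(S,U)+\rho(U)\cdot\omega(S,T)-\omega([S,T],U)+\omega([S,U],T)-\omega([T,U],S)$), $J$ is a smooth bundle endomorphism of $A$ over the identity with $J^2=-\mathrm{id}$, $g$ is a smooth Riemannian metric on $A$, and $g(JS,JT)=g(S,T)$, $\omega(S,T)=g(S,JT)$ for all $S,T$. For $x\in M$ and a subspace $W\subseteq A_x$ put $W^\omega=\{a\in A_x:\omega(a,b)=0\ \forall b\in W\}$,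 and let $L_x=\ker\rho_x$, $L^1_x=L_x\cap L_x^\omega$, $L^2_x$ the $g$-orthogonal complement of $L^1_x$ in $L_x$, $E^1_x=J(L^1_x)$, $E^2_x=(L_x+E^1_x)^\omega$ and $\Lambda_x=\rho(E^2_x+L^1_x)\subseteq T_xM$. For $f\in C^\infty(M)$ let $a_f$ be the Hamiltonian section of $f$, determined by $\rho(b)\cdot f=\omega(a_f,b)$ for all $b\in A$, and put $\{f,h\}=\omega(a_f,a_h)$. An integral submanifold of $\Lambda$ is a finite-dimensional smooth manifold $\mathcal O$ with an injective immersion $\iota:\mathcal O\to M$ such that $d\iota(T_p\mathcal O)=\Lambda_{\iota(p)}$ for every $p\in\mathcal O$. Then: 1. $A_x=(E^1_x+E^2_x)\oplus(L^1_x+L^2_x)$ for every $x\in M$. 2. $\Lambda$ is a smooth generalized distribution (every $v\in\Lambda_x$ is the value at $x$ of a smooth vector field on $M$ with values in $\Lambda$), and it is integrable: through every point of $M$ passes a connected integral submanifold of $\Lambda$. 3. $\{\cdot,\cdot\}$ is a Poisson bracket on $C^\infty(M)$. 4. For every integral submanifold $\iota:\mathcal O\to M$ of $\Lambda$ there is exactly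 one symplectic form $\omega_{\mathcal O}$ on $\mathcal O$ such that $\omega_{\mathcal O}(X,Y)=\omega(a,b)$ for all $p\in\mathcal O$, $X,Y\in T_p\mathcal O$ and $a,b\in E^2_{\iota(p)}+L^1_{\iota(p)}$ with $\rho(a)=d\iota(X)$, $\rho(b)=d\iota(Y)$. Let $\{u,v\}_{\mathcal O}=\omega_{\mathcal O}(X_u,X_v)$ for $u,v\in C^\infty(\mathcal O)$, where the Hamiltonian vector field $X_u$ is determined by $du=\omega_{\mathcal O}(X_u,\cdot)$. Then $\{\cdot,\cdot\}_{\mathcal O}$ is a Poisson bracket and, for all $f,h\in C^\infty(M)$, $$\{f,h\}|_{\mathcal O}=\{f|_{\mathcal O},h|_{\mathcal O}\}_{\mathcal O},\qquad\text{where } f|_{\mathcal O}=f\circ\iota .$$ -/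

import Mathlib

open Bundle VectorField
open scoped Manifold ContDiff

noncomputable section

/-! Manifolds are modelled on a finite-dimensional real normed space `E` (no boundary), and vector
bundles have a finite-dimensional model fibre `V`. -/

section Algebroids

variable {E : Type*} [NormedAddCommGroup E] [NormedSpace ℝ E]
  {M : Type*} [TopologicalSpace M] [ChartedSpace E M]
  {V : Type*} [NormedAddCommGroup V] [NormedSpace ℝ V]
  {A : M → Type*} [TopologicalSpace (TotalSpace V A)]
  [∀ x, AddCommGroup (A x)] [∀ x, Module ℝ (A x)] [∀ x, TopologicalSpace (A x)]
  [FiberBundle V A] [VectorBundle ℝ V A]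

/-- The product of a smooth function and a smooth section. -/
def sectionSMul (f : C^∞⟮𝓘(ℝ, E), M; ℝ⟯) (S : Cₛ^∞⟮𝓘(ℝ, E); V, A⟯) :
    Cₛ^∞⟮𝓘(ℝ, E); V, A⟯ :=
  ⟨fun x => f x • S x, f.contMDiff.smul_section S.contMDiff⟩

variable (E V A) in
/-- A Lie algebroid structure on the smooth vector bundle `A` over `M`. -/
structure LieAlgebroid [IsManifold 𝓘(ℝ, E) ∞ M] where
  /-- The anchor `A → TM`. -/
  anchor (x : M) : A x →L[ℝ] TangentSpace 𝓘(ℝ, E) x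
  /-- The anchor is a smooth map of total spaces. -/
  contMDiff_anchor : ContMDiff (𝓘(ℝ, E).prod 𝓘(ℝ, V)) 𝓘(ℝ, E).tangent ∞
    (fun v : TotalSpace V A => (⟨v.proj, anchor v.proj v.snd⟩ : TangentBundle 𝓘(ℝ, E) M))
  /-- The bracket on the space of smooth sections. -/
  bracket : Cₛ^∞⟮𝓘(ℝ, E); V, A⟯ →ₗ[ℝ] Cₛ^∞⟮𝓘(ℝ, E); V, A⟯ →ₗ[ℝ] Cₛ^∞⟮𝓘(ℝ, E); V, A⟯
  bracket_self (S : Cₛ^∞⟮𝓘(ℝ, E); V, A⟯) : bracket S S = 0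
  jacobi (S T U : Cₛ^∞⟮𝓘(ℝ, E); V, A⟯) :
    bracket S (bracket T U) = bracket (bracket S T) U + bracket T (bracket S U)
  anchor_bracket (S T : Cₛ^∞⟮𝓘(ℝ, E); V, A⟯) (x : M) :
    anchor x (bracket S T x) =
      mlieBracket 𝓘(ℝ, E) (fun y => anchor y (S y)) (fun y => anchor y (T y)) x
  leibniz (S T : Cₛ^∞⟮𝓘(ℝ, E); V, A⟯) (f : C^∞⟮𝓘(ℝ, E), M; ℝ⟯) (x : M) :
    bracket S (sectionSMul f T) x =
      f x • bracket S T x + mvfderiv 𝓘(ℝ, E) f x (anchor x (S x)) • T x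

namespace LieAlgebroid

variable [IsManifold 𝓘(ℝ, E) ∞ M]

/-- The differential of a smooth function: `(d^A f)(b) = ρ(b) · f` for `b` in the fibre at `x`. -/
def d₀ (𝓐 : LieAlgebroid E V A) (f : C^∞⟮𝓘(ℝ, E), M; ℝ⟯) (x : M) : A x →L[ℝ] ℝ :=
  (mvfderiv 𝓘(ℝ, E) f x).comp (𝓐.anchor x)

/-- The exterior derivative `(d^A η)(S, T, U)` of a 2-form `η` on `A`. -/
def d₂ (𝓐 : LieAlgebroid E V A) (η : ∀ x, A x →L[ℝ] A x →L[ℝ] ℝ)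
    (S T U : Cₛ^∞⟮𝓘(ℝ, E); V, A⟯) (x : M) : ℝ :=
  mvfderiv 𝓘(ℝ, E) (fun y => η y (T y) (U y)) x (𝓐.anchor x (S x))
    - mvfderiv 𝓘(ℝ, E) (fun y => η y (S y) (U y)) x (𝓐.anchor x (T x))
    + mvfderiv 𝓘(ℝ, E) (fun y => η y (S y) (T y)) x (𝓐.anchor x (U x))
    - η x (𝓐.bracket S T x) (U x)
    + η x (𝓐.bracket S U x) (T x)
    - η x (𝓐.bracket T U x) (S x)

/-- The kernel of the anchor at `x`. -/
def L (𝓐 : LieAlgebroid E V A) (x : M) : Submodule ℝ (A x) :=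
  LinearMap.ker (𝓐.anchor x).toLinearMap

end LieAlgebroid

variable [IsManifold 𝓘(ℝ, E) ∞ M]
  [∀ x, IsTopologicalAddGroup (A x)] [∀ x, ContinuousConstSMul ℝ (A x)]

/-- A symplectic form on a Lie algebroid: a smooth, alternating, nondegenerate, closed 2-form. -/
@[ext]
structure SymplecticForm (𝓐 : LieAlgebroid E V A) where
  form (x : M) : A x →L[ℝ] A x →L[ℝ] ℝ
  contMDiff : ContMDiff 𝓘(ℝ, E) (𝓘(ℝ, E).prod 𝓘(ℝ, V →L[ℝ] V →L[ℝ] ℝ)) ∞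
    (fun x => TotalSpace.mk' (V →L[ℝ] V →L[ℝ] ℝ) x (form x))
  alternating (x : M) (a : A x) : form x a a = 0
  nondegenerate (x : M) (a : A x) : (∀ b, form x a b = 0) → a = 0
  closed (S T U : Cₛ^∞⟮𝓘(ℝ, E); V, A⟯) (x : M) : 𝓐.d₂ form S T U x = 0

namespace SymplecticForm

variable {𝓐 : LieAlgebroid E V A} (Ω : SymplecticForm 𝓐)

/-- The `Ω`-orthogonal of a subspace of a fibre. -/
def orth (x : M) (W : Submodule ℝ (A x)) : Submodule ℝ (A x) where
  carrier := {a | ∀ b ∈ W, Ω.form x a b = 0}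
  add_mem' ha ha' b hb := by simp [ha b hb, ha' b hb]
  zero_mem' b _ := by simp
  smul_mem' c a ha b hb := by simp [ha b hb]

theorem existsUnique_hamiltonian [FiniteDimensional ℝ V] (f : C^∞⟮𝓘(ℝ, E), M; ℝ⟯) (x : M) :
    ∃! a : A x, ∀ b : A x, 𝓐.d₀ f x b = Ω.form x a b := by
  have : FiniteDimensional ℝ (A x) := VectorBundle.finiteDimensional ℝ V A x
  let B : A x →ₗ[ℝ] Module.Dual ℝ (A x) :=
    { toFun := fun a => (Ω.form x a).toLinearMap
      map_add' := fun a b => by ext; simp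
      map_smul' := fun c a => by ext; simp }
  have hinj : Function.Injective B := by
    rw [injective_iff_map_eq_zero]
    intro a ha
    exact Ω.nondegenerate x a fun b => LinearMap.congr_fun ha b
  have hsurj : Function.Surjective B :=
    (LinearMap.injective_iff_surjective_of_finrank_eq_finrank
      (Subspace.dual_finrank_eq (K := ℝ) (V := A x)).symm).1 hinj
  obtain ⟨a, ha⟩ := hsurj (𝓐.d₀ f x).toLinearMap
  refine ⟨a, fun b => (LinearMap.congr_fun ha b).symm, fun a' ha' => hinj ?_⟩
  ext b
  exact (ha' b).symm.trans (LinearMap.congr_fun ha b).symm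

/-- The Hamiltonian section `a_f` of `f`, determined by `d^A f (b) = Ω (a_f, b)` for all `b`. -/
def hamiltonian [FiniteDimensional ℝ V] (f : C^∞⟮𝓘(ℝ, E), M; ℝ⟯) (x : M) : A x :=
  (Ω.existsUnique_hamiltonian f x).choose

/-- The bracket `{f, h} = Ω (a_f, a_h)` induced by `Ω` on functions on the base. -/
def poissonBracket [FiniteDimensional ℝ V] (f h : C^∞⟮𝓘(ℝ, E), M; ℝ⟯) (x : M) : ℝ :=
  Ω.form x (Ω.hamiltonian f x) (Ω.hamiltonian h x)

end SymplecticForm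

/-- A compatible triple `(Ω, J, g)` on a Lie algebroid. -/
structure CompatibleTriple (𝓐 : LieAlgebroid E V A) where
  Ω : SymplecticForm 𝓐
  /-- The almost complex structure, a smooth bundle endomorphism over the identity. -/
  J (x : M) : A x →L[ℝ] A x
  contMDiff_J : ContMDiff (𝓘(ℝ, E).prod 𝓘(ℝ, V)) (𝓘(ℝ, E).prod 𝓘(ℝ, V)) ∞
    (fun v : TotalSpace V A => (⟨v.proj, J v.proj v.snd⟩ : TotalSpace V A))
  J_J (x : M) (a : A x) : J x (J x a) = -a
  /-- The Riemannian metric on the fibres. -/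
  g : ContMDiffRiemannianMetric 𝓘(ℝ, E) ∞ V A
  g_J_J (x : M) (a b : A x) : g.inner x (J x a) (J x b) = g.inner x a b
  Ω_eq (x : M) (a b : A x) : Ω.form x a b = g.inner x a (J x b)

namespace CompatibleTriple

variable {𝓐 : LieAlgebroid E V A} (τ : CompatibleTriple 𝓐)

/-- `L¹ = L ∩ L^Ω`. -/
def L₁ (x : M) : Submodule ℝ (A x) := 𝓐.L x ⊓ τ.Ω.orth x (𝓐.L x)

/-- `L²`, the `g`-orthogonal complement of `L¹` in `L`. -/
def L₂ (x : M) : Submodule ℝ (A x) where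
  carrier := {s | s ∈ 𝓐.L x ∧ ∀ t ∈ τ.L₁ x, τ.g.inner x s t = 0}
  add_mem' ha hb := ⟨add_mem ha.1 hb.1, fun t ht => by simp [ha.2 t ht, hb.2 t ht]⟩
  zero_mem' := ⟨zero_mem _, fun t _ => by simp⟩
  smul_mem' c a ha := ⟨Submodule.smul_mem _ c ha.1, fun t ht => by simp [ha.2 t ht]⟩

/-- `E¹ = J(L¹)`. -/
def E₁ (x : M) : Submodule ℝ (A x) := (τ.L₁ x).map (τ.J x).toLinearMap

/-- `E² = (L + E¹)^Ω`. -/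
def E₂ (x : M) : Submodule ℝ (A x) := τ.Ω.orth x (𝓐.L x ⊔ τ.E₁ x)

/-- The symplectic generalized distribution `Λ = ρ(E² + L¹)`. -/
def Λ (x : M) : Submodule ℝ (TangentSpace 𝓘(ℝ, E) x) :=
  (τ.E₂ x ⊔ τ.L₁ x).map (𝓐.anchor x).toLinearMap

end CompatibleTriple

end Algebroids

section Manifolds

variable {E : Type*} [NormedAddCommGroup E] [NormedSpace ℝ E]
  {M : Type*} [TopologicalSpace M] [ChartedSpace E M]

/-- `P` is a Poisson bracket on the smooth functions on `M`. -/
structure IsPoissonBracket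
    (P : C^∞⟮𝓘(ℝ, E), M; ℝ⟯ → C^∞⟮𝓘(ℝ, E), M; ℝ⟯ → M → ℝ) : Prop where
  contMDiff (f h : C^∞⟮𝓘(ℝ, E), M; ℝ⟯) : ContMDiff 𝓘(ℝ, E) 𝓘(ℝ, ℝ) ∞ (P f h)
  add_left (f₁ f₂ h : C^∞⟮𝓘(ℝ, E), M; ℝ⟯) : P (f₁ + f₂) h = P f₁ h + P f₂ h
  smul_left (c : ℝ) (f h : C^∞⟮𝓘(ℝ, E), M; ℝ⟯) : P (c • f) h = c • P f h
  skew (f h : C^∞⟮𝓘(ℝ, E), M; ℝ⟯) : P f h = -P h f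
  leibniz (f h k : C^∞⟮𝓘(ℝ, E), M; ℝ⟯) : P f (h * k) = P f h * k + h * P f k
  jacobi (f h k : C^∞⟮𝓘(ℝ, E), M; ℝ⟯) :
    P f ⟨P h k, contMDiff h k⟩ + P h ⟨P k f, contMDiff k f⟩ + P k ⟨P f h, contMDiff f h⟩ = 0

/-- A generalized distribution (of possibly varying rank) is smooth if each of its vectors is the
value of a smooth vector field tangent to the distribution. -/
def IsSmoothDistribution [IsManifold 𝓘(ℝ, E) ∞ M]
    (D : ∀ x : M, Submodule ℝ (TangentSpace 𝓘(ℝ, E) x)) : Prop :=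
  ∀ (x : M), ∀ v ∈ D x,
    ∃ X : Cₛ^∞⟮𝓘(ℝ, E); E, (TangentSpace 𝓘(ℝ, E) : M → Type _)⟯, X x = v ∧ ∀ y, X y ∈ D y

/-- `ι : O → M` is an integral submanifold of `D`: an injective immersion whose tangent spaces are
the spaces of the distribution. -/
structure IsIntegralSubmanifold (D : ∀ x : M, Submodule ℝ (TangentSpace 𝓘(ℝ, E) x))
    {F : Type*} [NormedAddCommGroup F] [NormedSpace ℝ F]
    {O : Type*} [TopologicalSpace O] [ChartedSpace F O] (ι : O → M) : Prop where
  contMDiff : ContMDiff 𝓘(ℝ, F) 𝓘(ℝ, E) ∞ ι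
  injective : Function.Injective ι
  immersion (p : O) : Function.Injective (mfderiv 𝓘(ℝ, F) 𝓘(ℝ, E) ι p)
  range_mfderiv (p : O) :
    LinearMap.range (mfderiv 𝓘(ℝ, F) 𝓘(ℝ, E) ι p).toLinearMap = D (ι p)

/-- A generalized distribution is integrable if a connected integral submanifold passes through
every point. -/
def IsIntegrableDistribution (D : ∀ x : M, Submodule ℝ (TangentSpace 𝓘(ℝ, E) x)) : Prop :=
  ∀ x : M, ∃ (k : ℕ) (O : Type) (_ : TopologicalSpace O)
    (_ : ChartedSpace (EuclideanSpace ℝ (Fin k)) O)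
    (_ : IsManifold 𝓘(ℝ, EuclideanSpace ℝ (Fin k)) ∞ O)
    (_ : T2Space O) (_ : SecondCountableTopology O) (_ : ConnectedSpace O) (ι : O → M),
    IsIntegralSubmanifold (F := EuclideanSpace ℝ (Fin k)) D ι ∧ x ∈ Set.range ι

theorem mdifferentiableAt_vectorField [IsManifold 𝓘(ℝ, E) ∞ M]
    (S : Cₛ^∞⟮𝓘(ℝ, E); E, (TangentSpace 𝓘(ℝ, E) : M → Type _)⟯) (x : M) :
    MDifferentiableAt 𝓘(ℝ, E) 𝓘(ℝ, E).tangent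
      (fun y => (⟨y, S y⟩ : TangentBundle 𝓘(ℝ, E) M)) x :=
  S.contMDiff.mdifferentiable (by simp) x

theorem contMDiff_mlieBracket_section [FiniteDimensional ℝ E] [IsManifold 𝓘(ℝ, E) ∞ M]
    (S T : Cₛ^∞⟮𝓘(ℝ, E); E, (TangentSpace 𝓘(ℝ, E) : M → Type _)⟯) :
    ContMDiff 𝓘(ℝ, E) 𝓘(ℝ, E).tangent ∞
      (fun y => (⟨y, mlieBracket 𝓘(ℝ, E) S T y⟩ : TangentBundle 𝓘(ℝ, E) M)) := by
  have : CompleteSpace E := FiniteDimensional.complete ℝ E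
  have : IsManifold 𝓘(ℝ, E) (((⊤ : ℕ∞) : ℕ∞ω) + 1) M := by
    simpa using (inferInstance : IsManifold 𝓘(ℝ, E) ∞ M)
  have : IsManifold 𝓘(ℝ, E) (minSmoothness ℝ 2) M := by
    simp only [minSmoothness_of_isRCLikeNormedField]; infer_instance
  exact ContDiff.mlieBracket_vectorField (m := ⊤) (n := ⊤) S.contMDiff T.contMDiff (by simp)

variable (E M) in
/-- The tangent Lie algebroid: `TM` with the identity as anchor and the bracket of vector fields.
A symplectic form on it is a symplectic form on `M` in the usual sense. -/
def tangentLieAlgebroid [FiniteDimensional ℝ E] [IsManifold 𝓘(ℝ, E) ∞ M] :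
    LieAlgebroid E E (TangentSpace 𝓘(ℝ, E) : M → Type _) where
  anchor x := ContinuousLinearMap.id ℝ _
  contMDiff_anchor := contMDiff_id
  bracket :=
    LinearMap.mk₂ ℝ
      (fun S T => ⟨mlieBracket 𝓘(ℝ, E) S T, contMDiff_mlieBracket_section S T⟩)
      (fun S S' T => by
        have : CompleteSpace E := FiniteDimensional.complete ℝ E
        ext x
        exact mlieBracket_add_left (mdifferentiableAt_vectorField S x)
          (mdifferentiableAt_vectorField S' x))
      (fun c S T => by
        have : CompleteSpace E := FiniteDimensional.complete ℝ E
        ext x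
        exact mlieBracket_const_smul_left (mdifferentiableAt_vectorField S x))
      (fun S T T' => by
        have : CompleteSpace E := FiniteDimensional.complete ℝ E
        ext x
        exact mlieBracket_add_right (mdifferentiableAt_vectorField T x)
          (mdifferentiableAt_vectorField T' x))
      (fun c S T => by
        have : CompleteSpace E := FiniteDimensional.complete ℝ E
        ext x
        exact mlieBracket_const_smul_right (mdifferentiableAt_vectorField T x))
  bracket_self S := by
    ext x
    exact congrFun mlieBracket_self x
  jacobi S T U := by
    have : CompleteSpace E := FiniteDimensional.complete ℝ E
    have : IsManifold 𝓘(ℝ, E) (minSmoothness ℝ 3) M := by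
      simp only [minSmoothness_of_isRCLikeNormedField]; infer_instance
    have hd (S : Cₛ^∞⟮𝓘(ℝ, E); E, (TangentSpace 𝓘(ℝ, E) : M → Type _)⟯) (x : M) :
        ContMDiffAt 𝓘(ℝ, E) 𝓘(ℝ, E).tangent (minSmoothness ℝ 2)
          (fun y => (⟨y, S y⟩ : TangentBundle 𝓘(ℝ, E) M)) x :=
      (S.contMDiff x).of_le (by
        simp only [minSmoothness_of_isRCLikeNormedField]; exact ENat.LEInfty.out)
    ext x
    exact leibniz_identity_mlieBracket_apply (hd S x) (hd T x) (hd U x)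
  anchor_bracket S T x := rfl
  leibniz S T f x := by
    have : CompleteSpace E := FiniteDimensional.complete ℝ E
    rw [add_comm]
    exact mlieBracket_smul_right (f.contMDiff.mdifferentiable (by simp) x)
      (mdifferentiableAt_vectorField T x)

end Manifolds

/-- `ΩO` is the 2-form induced on the integral submanifold `ι : O → M` of `Λ`:
`ΩO (X, Y) = Ω (a, b)` whenever `a, b ∈ E² + L¹` lift `X, Y`. -/
def IsInducedForm {E : Type*} [NormedAddCommGroup E] [NormedSpace ℝ E]
    {M : Type*} [TopologicalSpace M] [ChartedSpace E M] [IsManifold 𝓘(ℝ, E) ∞ M]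
    {V : Type*} [NormedAddCommGroup V] [NormedSpace ℝ V]
    {A : M → Type*} [TopologicalSpace (TotalSpace V A)]
    [∀ x, AddCommGroup (A x)] [∀ x, Module ℝ (A x)] [∀ x, TopologicalSpace (A x)]
    [∀ x, IsTopologicalAddGroup (A x)] [∀ x, ContinuousConstSMul ℝ (A x)]
    [FiberBundle V A] [VectorBundle ℝ V A]
    {𝓐 : LieAlgebroid E V A} (τ : CompatibleTriple 𝓐)
    {F : Type*} [NormedAddCommGroup F] [NormedSpace ℝ F] [FiniteDimensional ℝ F]
    {O : Type*} [TopologicalSpace O] [ChartedSpace F O] [IsManifold 𝓘(ℝ, F) ∞ O]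
    (ι : O → M) (ΩO : SymplecticForm (tangentLieAlgebroid F O)) : Prop :=
  ∀ (p : O) (X Y : TangentSpace 𝓘(ℝ, F) p), ∀ a ∈ τ.E₂ (ι p) ⊔ τ.L₁ (ι p),
    ∀ b ∈ τ.E₂ (ι p) ⊔ τ.L₁ (ι p),
    𝓐.anchor (ι p) a = mfderiv 𝓘(ℝ, F) 𝓘(ℝ, E) ι p X →
    𝓐.anchor (ι p) b = mfderiv 𝓘(ℝ, F) 𝓘(ℝ, E) ι p Y →
    ΩO.form p X Y = τ.Ω.form (ι p) a b

end

/-! Because `Ω(a, J l) = -g(a, l)`, the space `E²` is the `g`-orthogonal complement of `L¹` in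
`L^Ω`, so `E² + L¹ = L^Ω` (`E₂_sup_L₁`) and `Λ = ρ(L^Ω)`: the auxiliary `J` and `g` disappear from
`Λ`. A vector `a` lies in `L^Ω` exactly when `Ω(a, ·)` vanishes on `ker ρ`, that is, when it is a
covector of `M` composed with `ρ`. By nondegeneracy this means that `a` is the value of a
Hamiltonian section. Hence `Λ` is the characteristic distribution of the bracket `{f, h} = ρ(a_h) ·
f` (`mem_Λ_iff_coordFun`), whose Jacobi identity is `dΩ = 0` evaluated on Hamiltonian sections.

Integrability is the local theorem on leaves of a Poisson tensor `B`, proved in a chart. Send a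
covector `ξ` to the time-one point of the integral curve of `z ↦ B(z) ξ` issuing from `x₀`. This map
is smooth near `0`, by the inverse function theorem on the Banach space of paths, and has
differential `B(x₀)` at `0`. By Jacobi, its differential at nearby `ξ` takes values in the range of
`B` (`exists_eq_apply_of_linearized`), and `B` at the endpoint is `Q B(x₀) Qᵗ` for some `Q`, so its
rank has not grown (`exists_conj_of_hamiltonian_flow`). Restricting to a complement of `ker B(x₀)`
yields an immersion, and a dimension count turns the inclusion of ranges into equality.

On an integral submanifold `O` the form `Ω` descends from `L^Ω` along `ρ`. The central identity is
`Ω_O(X_f, ·) = d(f|_O)`, where `dι(X_f) = ρ(a_f)` (`inducedForm_hamiltonianField`). Every tangent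
vector of `O` is some `X_f`, and functions restricted from `M` separate tangent vectors;
nondegeneracy, smoothness, closedness (from Jacobi on `M`) and the comparison of brackets follow. -/

/-! ### Smoothness criteria for sections -/

section SmoothSections

variable {E : Type*} [NormedAddCommGroup E] [NormedSpace ℝ E]
  {M : Type*} [TopologicalSpace M] [ChartedSpace E M]
  {V : Type*} [NormedAddCommGroup V] [NormedSpace ℝ V]
  {A : M → Type*} [TopologicalSpace (TotalSpace V A)]
  [∀ x, AddCommGroup (A x)] [∀ x, Module ℝ (A x)] [∀ x, TopologicalSpace (A x)]
  [FiberBundle V A] [VectorBundle ℝ V A]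

open Filter Topology in
/-- A section is smooth at `x₀` as soon as finitely many smooth families of linear forms, jointly
injective at `x₀`, take smooth values on it. -/
theorem contMDiffAt_section_of_linearForms [FiniteDimensional ℝ V]
    [ContMDiffVectorBundle ∞ V A 𝓘(ℝ, E)] {x₀ : M} (s : ∀ x, A x) {κ : Type*} [Finite κ]
    (φ : κ → ∀ x, A x →ₗ[ℝ] ℝ)
    (hφ : ∀ j (t : ∀ x, A x),
      ContMDiffAt 𝓘(ℝ, E) (𝓘(ℝ, E).prod 𝓘(ℝ, V)) ∞ (fun x => TotalSpace.mk' V x (t x)) x₀ →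
      ContMDiffAt 𝓘(ℝ, E) 𝓘(ℝ, ℝ) ∞ (fun x => φ j x (t x)) x₀)
    (hinj : ∀ a : A x₀, (∀ j, φ j x₀ a = 0) → a = 0)
    (hs : ∀ j, ContMDiffAt 𝓘(ℝ, E) 𝓘(ℝ, ℝ) ∞ (fun x => φ j x (s x)) x₀) :
    ContMDiffAt 𝓘(ℝ, E) (𝓘(ℝ, E).prod 𝓘(ℝ, V)) ∞ (fun x => TotalSpace.mk' V x (s x)) x₀ := by
  classical
  have := Fintype.ofFinite κ
  have : CompleteSpace V := FiniteDimensional.complete ℝ V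
  let e := trivializationAt V A x₀
  have hx₀ : x₀ ∈ e.baseSet := FiberBundle.mem_baseSet_trivializationAt V A x₀
  let b := Module.finBasis ℝ V
  let Φ : M → V →L[ℝ] (κ → ℝ) := fun x => ∑ i, ∑ j, φ j x (e.localFrame b i x) •
    (LinearMap.toContinuousLinearMap (b.coord i)).smulRight (Pi.single j (1 : ℝ))
  have hΦ_apply : ∀ x ∈ e.baseSet, ∀ a : A x, Φ x (e ⟨x, a⟩).2 = fun j => φ j x a := by
    intro x hx a
    have ha : a = ∑ i, b.repr (e ⟨x, a⟩).2 i • e.localFrame b i x := by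
      have h := (e.basisAt b hx).sum_repr a
      simp only [e.localFrame_apply_of_mem_baseSet b hx]
      conv_lhs => rw [← h]
      refine Finset.sum_congr rfl fun i _ => ?_
      congr 1
    ext j
    conv_rhs => rw [ha]
    simp [Φ, Finset.sum_apply, Pi.single_apply, mul_comm]
  have hΦ : ContMDiffAt 𝓘(ℝ, E) 𝓘(ℝ, V →L[ℝ] (κ → ℝ)) ∞ Φ x₀ := by
    refine ContMDiffAt.sum fun i _ => ContMDiffAt.sum fun j _ => ?_
    exact (hφ j _ (contMDiffAt_localFrame_of_mem ∞ e b i hx₀)).smul contMDiffAt_const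
  have hinj' : Function.Injective (Φ x₀) := by
    rw [injective_iff_map_eq_zero]
    intro v hv
    have h1 : (e ⟨x₀, e.symm x₀ v⟩).2 = v := by
      rw [e.apply_mk_symm hx₀]
    rw [← h1, hΦ_apply x₀ hx₀] at hv
    have h2 := hinj _ fun j => congrFun hv j
    rw [← h1, h2]
    exact (e.linearEquivAt ℝ x₀ hx₀).map_zero
  -- `Φ x` is the matrix of the forms in the trivialization. With a left inverse `S` of `Φ x₀`, the
  -- endomorphism `T x = S ∘ Φ x` is the identity at `x₀`, hence invertible nearby with smooth
  -- inverse, and applying that inverse to `S` of the prescribed values recovers the coordinates of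
  -- `s`.
  obtain ⟨S₀, hS₀⟩ := (Φ x₀).toLinearMap.exists_leftInverse_of_injective
    (LinearMap.ker_eq_bot.2 hinj')
  let S : (κ → ℝ) →L[ℝ] V := LinearMap.toContinuousLinearMap S₀
  let T : M → V →L[ℝ] V := fun x => S.comp (Φ x)
  have hT : ContMDiffAt 𝓘(ℝ, E) 𝓘(ℝ, V →L[ℝ] V) ∞ T x₀ := contMDiffAt_const.clm_comp hΦ
  have hTx₀ : T x₀ = (ContinuousLinearEquiv.refl ℝ V : V →L[ℝ] V) := by
    ext v
    exact LinearMap.congr_fun hS₀ v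
  have hTinv : ContMDiffAt 𝓘(ℝ, E) 𝓘(ℝ, V →L[ℝ] V) ∞ (fun x => (T x).inverse) x₀ := by
    have h : ContDiffAt ℝ ∞ ContinuousLinearMap.inverse (T x₀) := by
      rw [hTx₀]; exact contDiffAt_map_inverse _
    exact h.contMDiffAt.comp x₀ hT
  have hval : ContMDiffAt 𝓘(ℝ, E) 𝓘(ℝ, V) ∞ (fun x => S (fun j => φ j x (s x))) x₀ :=
    S.contMDiff.contMDiffAt.comp x₀ (contMDiffAt_pi_space.2 hs)
  rw [e.contMDiffAt_section_iff hx₀]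
  refine (hTinv.clm_apply hval).congr_of_eventuallyEq ?_
  have hev : ∀ᶠ x in 𝓝 x₀, T x ∈ Set.range ((↑) : (V ≃L[ℝ] V) → V →L[ℝ] V) := by
    refine hT.continuousAt.eventually ?_
    rw [hTx₀]
    exact ContinuousLinearEquiv.nhds _
  filter_upwards [hev, e.open_baseSet.mem_nhds hx₀] with x hx hxe
  obtain ⟨L, hL⟩ := hx
  have h3 : T x (e ⟨x, s x⟩).2 = S (fun j => φ j x (s x)) := by
    rw [← hΦ_apply x hxe]; rfl
  rw [← h3, ← hL]
  simp

theorem contMDiffAt_mvfderiv_apply [IsManifold 𝓘(ℝ, E) ∞ M] (f : C^∞⟮𝓘(ℝ, E), M; ℝ⟯)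
    {X : ∀ x : M, TangentSpace 𝓘(ℝ, E) x} {x : M}
    (hX : ContMDiffAt 𝓘(ℝ, E) 𝓘(ℝ, E).tangent ∞
      (fun y => (⟨y, X y⟩ : TangentBundle 𝓘(ℝ, E) M)) x) :
    ContMDiffAt 𝓘(ℝ, E) 𝓘(ℝ, ℝ) ∞ (fun y => mvfderiv 𝓘(ℝ, E) f y (X y)) x := by
  have h := f.contMDiff.contMDiff_tangentMap (m := ∞) (by simp)
  have h2 := (contMDiff_snd_tangentBundle_modelSpace (n := ∞) ℝ 𝓘(ℝ, ℝ)).contMDiffAt.comp x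
    (h.contMDiffAt.comp x hX)
  exact h2

end SmoothSections

/-! ### Calculus on a Lie algebroid -/

namespace LieAlgebroid

variable {E : Type*} [NormedAddCommGroup E] [NormedSpace ℝ E]
  {M : Type*} [TopologicalSpace M] [ChartedSpace E M] [IsManifold 𝓘(ℝ, E) ∞ M]
  {V : Type*} [NormedAddCommGroup V] [NormedSpace ℝ V]
  {A : M → Type*} [TopologicalSpace (TotalSpace V A)]
  [∀ x, AddCommGroup (A x)] [∀ x, Module ℝ (A x)] [∀ x, TopologicalSpace (A x)]
  [FiberBundle V A] [VectorBundle ℝ V A]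
  (𝓐 : LieAlgebroid E V A)

theorem contMDiffAt_anchor_apply {S : ∀ x, A x} {x : M}
    (hS : ContMDiffAt 𝓘(ℝ, E) (𝓘(ℝ, E).prod 𝓘(ℝ, V)) ∞ (fun y => TotalSpace.mk' V y (S y)) x) :
    ContMDiffAt 𝓘(ℝ, E) 𝓘(ℝ, E).tangent ∞
      (fun y => (⟨y, 𝓐.anchor y (S y)⟩ : TangentBundle 𝓘(ℝ, E) M)) x :=
  (𝓐.contMDiff_anchor.contMDiffAt).comp x hS

theorem contMDiffAt_d₀ (f : C^∞⟮𝓘(ℝ, E), M; ℝ⟯) {S : ∀ x, A x} {x : M}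
    (hS : ContMDiffAt 𝓘(ℝ, E) (𝓘(ℝ, E).prod 𝓘(ℝ, V)) ∞ (fun y => TotalSpace.mk' V y (S y)) x) :
    ContMDiffAt 𝓘(ℝ, E) 𝓘(ℝ, ℝ) ∞ (fun y => 𝓐.d₀ f y (S y)) x :=
  contMDiffAt_mvfderiv_apply f (𝓐.contMDiffAt_anchor_apply hS)

/-- The derivative `ρ(S) · f` of a function along a section. -/
noncomputable def derivAlong (S : Cₛ^∞⟮𝓘(ℝ, E); V, A⟯) (f : C^∞⟮𝓘(ℝ, E), M; ℝ⟯) :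
    C^∞⟮𝓘(ℝ, E), M; ℝ⟯ :=
  ⟨fun x => 𝓐.d₀ f x (S x), fun x => 𝓐.contMDiffAt_d₀ f (S.contMDiff x)⟩

theorem derivAlong_apply (S : Cₛ^∞⟮𝓘(ℝ, E); V, A⟯) (f : C^∞⟮𝓘(ℝ, E), M; ℝ⟯) (x : M) :
    𝓐.derivAlong S f x = mvfderiv 𝓘(ℝ, E) f x (𝓐.anchor x (S x)) := rfl

theorem leibniz_eq (S T : Cₛ^∞⟮𝓘(ℝ, E); V, A⟯) (f : C^∞⟮𝓘(ℝ, E), M; ℝ⟯) :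
    𝓐.bracket S (sectionSMul f T) =
      sectionSMul f (𝓐.bracket S T) + sectionSMul (𝓐.derivAlong S f) T := by
  ext x
  exact 𝓐.leibniz S T f x

/-- The anchor represents the bracket by the commutator of derivations. -/
theorem mvfderiv_anchor_bracket (S T : Cₛ^∞⟮𝓘(ℝ, E); V, A⟯) (f : C^∞⟮𝓘(ℝ, E), M; ℝ⟯) (x : M) :
    mvfderiv 𝓘(ℝ, E) f x (𝓐.anchor x (𝓐.bracket S T x)) =
      mvfderiv 𝓘(ℝ, E) (𝓐.derivAlong T f) x (𝓐.anchor x (S x)) -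
        mvfderiv 𝓘(ℝ, E) (𝓐.derivAlong S f) x (𝓐.anchor x (T x)) := by
  -- Expand Jacobi for `S`, `T`, `f U` by Leibniz and remove `f` times Jacobi for `S`, `T`, `U`:
  -- what is left is a multiple of `U x`, with the desired difference as coefficient.
  have key : ∀ U : Cₛ^∞⟮𝓘(ℝ, E); V, A⟯,
      (mvfderiv 𝓘(ℝ, E) f x (𝓐.anchor x (𝓐.bracket S T x)) -
      (mvfderiv 𝓘(ℝ, E) (𝓐.derivAlong T f) x (𝓐.anchor x (S x)) -
        mvfderiv 𝓘(ℝ, E) (𝓐.derivAlong S f) x (𝓐.anchor x (T x)))) • U x = 0 := by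
    intro U
    have h := congrArg (fun W : Cₛ^∞⟮𝓘(ℝ, E); V, A⟯ => W x) (𝓐.jacobi S T (sectionSMul f U))
    have hJ := congrArg (fun W : Cₛ^∞⟮𝓘(ℝ, E); V, A⟯ => W x) (𝓐.jacobi S T U)
    rw [𝓐.leibniz_eq T U f, 𝓐.leibniz_eq S U f] at h
    simp only [map_add, ContMDiffSection.coe_add, Pi.add_apply, 𝓐.leibniz, derivAlong_apply] at h hJ
    rw [hJ] at h
    simp only [sub_smul]
    rw [← sub_eq_zero] at h
    rw [← neg_eq_zero, ← h]
    module
  by_cases hU : ∃ U : Cₛ^∞⟮𝓘(ℝ, E); V, A⟯, U x ≠ 0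
  · obtain ⟨U, hU⟩ := hU
    exact sub_eq_zero.1 ((smul_eq_zero.1 (key U)).resolve_right hU)
  -- If all sections vanish at `x`, every anchor value in the formula is zero.
  · push Not at hU
    simp [hU]

/-- The differential of a 2-form on sections which are Hamiltonian for it. -/
theorem d₂_of_hamiltonian (η : ∀ x, A x →L[ℝ] A x →L[ℝ] ℝ) (hη : ∀ x a, η x a a = 0)
    {S T U : Cₛ^∞⟮𝓘(ℝ, E); V, A⟯} {f h k : C^∞⟮𝓘(ℝ, E), M; ℝ⟯}
    (hS : ∀ x b, 𝓐.d₀ f x b = η x (S x) b) (hT : ∀ x b, 𝓐.d₀ h x b = η x (T x) b)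
    (hU : ∀ x b, 𝓐.d₀ k x b = η x (U x) b) (x : M) :
    𝓐.d₂ η S T U x =
      -(mvfderiv 𝓘(ℝ, E) (fun y => η y (T y) (U y)) x (𝓐.anchor x (S x)) +
        mvfderiv 𝓘(ℝ, E) (fun y => η y (U y) (S y)) x (𝓐.anchor x (T x)) +
        mvfderiv 𝓘(ℝ, E) (fun y => η y (S y) (T y)) x (𝓐.anchor x (U x))) := by
  have hskew : ∀ x a b, η x a b = -η x b a := by
    intro x a b
    have h := hη x (a + b)
    simp only [map_add, add_apply, hη, zero_add, add_zero] at h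
    linarith
  have hmskew : ∀ (P Q : Cₛ^∞⟮𝓘(ℝ, E); V, A⟯) (v : TangentSpace 𝓘(ℝ, E) x),
      mvfderiv 𝓘(ℝ, E) (fun y => η y (P y) (Q y)) x v =
        -mvfderiv 𝓘(ℝ, E) (fun y => η y (Q y) (P y)) x v := by
    intro P Q v
    rw [show (fun y => η y (P y) (Q y)) = fun y => -η y (Q y) (P y) from
      funext fun y => hskew _ _ _, mvfderiv_fun_neg]
    simp
  have hbr : ∀ (P Q R : Cₛ^∞⟮𝓘(ℝ, E); V, A⟯) (u : C^∞⟮𝓘(ℝ, E), M; ℝ⟯),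
      (∀ x b, 𝓐.d₀ u x b = η x (R x) b) →
      η x (𝓐.bracket P Q x) (R x) =
        -(mvfderiv 𝓘(ℝ, E) (fun y => η y (R y) (Q y)) x (𝓐.anchor x (P x)) -
          mvfderiv 𝓘(ℝ, E) (fun y => η y (R y) (P y)) x (𝓐.anchor x (Q x))) := by
    intro P Q R u hu
    rw [hskew, ← hu, d₀, ContinuousLinearMap.comp_apply, 𝓐.mvfderiv_anchor_bracket]
    have hd : ∀ Z : Cₛ^∞⟮𝓘(ℝ, E); V, A⟯,
        (𝓐.derivAlong Z u : M → ℝ) = fun y => η y (R y) (Z y) := fun Z => funext fun y => hu y _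
    rw [hd, hd]
  rw [d₂, hbr S T U k hU, hbr S U T h hT, hbr T U S f hS, hmskew U T, hmskew T S, hmskew U S]
  ring

end LieAlgebroid

/-! ### Hamiltonian sections and the Poisson bracket -/

namespace SymplecticForm

variable {E : Type*} [NormedAddCommGroup E] [NormedSpace ℝ E]
  {M : Type*} [TopologicalSpace M] [ChartedSpace E M] [IsManifold 𝓘(ℝ, E) ∞ M]
  {V : Type*} [NormedAddCommGroup V] [NormedSpace ℝ V] [FiniteDimensional ℝ V]
  {A : M → Type*} [TopologicalSpace (TotalSpace V A)]
  [∀ x, AddCommGroup (A x)] [∀ x, Module ℝ (A x)] [∀ x, TopologicalSpace (A x)]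
  [∀ x, IsTopologicalAddGroup (A x)] [∀ x, ContinuousConstSMul ℝ (A x)]
  [FiberBundle V A] [VectorBundle ℝ V A]
  {𝓐 : LieAlgebroid E V A} (Ω : SymplecticForm 𝓐)

theorem skew (x : M) (a b : A x) : Ω.form x a b = -Ω.form x b a := by
  have h := Ω.alternating x (a + b)
  simp only [map_add, add_apply, Ω.alternating, zero_add, add_zero] at h
  linarith

/-- The form at a point as a linear map to the algebraic dual. -/
noncomputable def formₗ (x : M) : A x →ₗ[ℝ] A x →ₗ[ℝ] ℝ where
  toFun a := (Ω.form x a).toLinearMap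
  map_add' a b := by ext; simp
  map_smul' c a := by ext; simp

theorem form_hamiltonian (f : C^∞⟮𝓘(ℝ, E), M; ℝ⟯) (x : M) (b : A x) :
    Ω.form x (Ω.hamiltonian f x) b = 𝓐.d₀ f x b :=
  ((Ω.existsUnique_hamiltonian f x).choose_spec.1 b).symm

theorem eq_hamiltonian {f : C^∞⟮𝓘(ℝ, E), M; ℝ⟯} {x : M} {a : A x}
    (h : ∀ b, 𝓐.d₀ f x b = Ω.form x a b) : a = Ω.hamiltonian f x :=
  (Ω.existsUnique_hamiltonian f x).unique h fun b => (Ω.form_hamiltonian f x b).symm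

theorem poissonBracket_apply (f h : C^∞⟮𝓘(ℝ, E), M; ℝ⟯) (x : M) :
    Ω.poissonBracket f h x = mvfderiv 𝓘(ℝ, E) f x (𝓐.anchor x (Ω.hamiltonian h x)) :=
  Ω.form_hamiltonian f x _

theorem poissonBracket_skew (f h : C^∞⟮𝓘(ℝ, E), M; ℝ⟯) (x : M) :
    Ω.poissonBracket f h x = -Ω.poissonBracket h f x :=
  Ω.skew x _ _

variable [ContMDiffVectorBundle ∞ V A 𝓘(ℝ, E)]

theorem contMDiffAt_form_apply {S T : ∀ x, A x} {x : M}
    (hS : ContMDiffAt 𝓘(ℝ, E) (𝓘(ℝ, E).prod 𝓘(ℝ, V)) ∞ (fun y => TotalSpace.mk' V y (S y)) x)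
    (hT : ContMDiffAt 𝓘(ℝ, E) (𝓘(ℝ, E).prod 𝓘(ℝ, V)) ∞ (fun y => TotalSpace.mk' V y (T y)) x) :
    ContMDiffAt 𝓘(ℝ, E) 𝓘(ℝ, ℝ) ∞ (fun y => Ω.form y (S y) (T y)) x := by
  have hc : ∀ x, ContinuousSMul ℝ (A x) := fun x =>
    (VectorBundle.continuousLinearEquivAt ℝ V A x).continuousSMul
  have h := ContMDiffAt.clm_bundle_apply₂ (F₁ := V) (F₂ := V) (F₃ := ℝ)
    (E₃ := Bundle.Trivial M ℝ) (Ω.contMDiff x) hS hT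
  simpa only [Bundle.contMDiffAt_section, Bundle.Trivial.fiberBundle_trivializationAt',
    Bundle.Trivial.trivialization_apply] using h

/-- Pairing `a_f` with a local frame `e_j` gives the smooth functions `ρ(e_j) · f`, and by
nondegeneracy these pairings determine a vector. -/
theorem contMDiff_hamiltonian (f : C^∞⟮𝓘(ℝ, E), M; ℝ⟯) :
    ContMDiff 𝓘(ℝ, E) (𝓘(ℝ, E).prod 𝓘(ℝ, V)) ∞
      (fun x => TotalSpace.mk' V x (Ω.hamiltonian f x)) := by
  intro x₀
  let e := trivializationAt V A x₀
  have hx₀ : x₀ ∈ e.baseSet := FiberBundle.mem_baseSet_trivializationAt V A x₀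
  let b := Module.finBasis ℝ V
  have hs := fun j => contMDiffAt_localFrame_of_mem (I := 𝓘(ℝ, E)) ∞ e b j hx₀
  refine contMDiffAt_section_of_linearForms (Ω.hamiltonian f)
    (fun j x => (LinearMap.applyₗ (e.localFrame b j x)).comp (Ω.formₗ x)) ?_ ?_ ?_
  · intro j t ht
    exact Ω.contMDiffAt_form_apply ht (hs j)
  · intro a ha
    refine Ω.nondegenerate x₀ a fun c => ?_
    have hc := (e.basisAt b hx₀).sum_repr c
    rw [← hc, map_sum]
    refine Finset.sum_eq_zero fun i _ => ?_
    have h := ha i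
    simp only [e.localFrame_apply_of_mem_baseSet b hx₀] at h
    rw [map_smul]
    exact (congrArg _ h).trans (smul_zero _)
  · intro j
    refine (𝓐.contMDiffAt_d₀ f (hs j)).congr_of_eventuallyEq (.of_forall fun x => ?_)
    exact Ω.form_hamiltonian f x _

/-- The Hamiltonian section as a smooth section. -/
noncomputable def hamiltonianSection (f : C^∞⟮𝓘(ℝ, E), M; ℝ⟯) : Cₛ^∞⟮𝓘(ℝ, E); V, A⟯ :=
  ⟨Ω.hamiltonian f, Ω.contMDiff_hamiltonian f⟩

theorem contMDiff_poissonBracket (f h : C^∞⟮𝓘(ℝ, E), M; ℝ⟯) :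
    ContMDiff 𝓘(ℝ, E) 𝓘(ℝ, ℝ) ∞ (Ω.poissonBracket f h) := fun x =>
  Ω.contMDiffAt_form_apply (Ω.contMDiff_hamiltonian f x) (Ω.contMDiff_hamiltonian h x)

/-- Since `{f, h} = ρ(a_h) · f`, linearity and Leibniz are those of a derivation; Jacobi is
closedness of `Ω` on three Hamiltonian sections. -/
theorem isPoissonBracket : IsPoissonBracket Ω.poissonBracket where
  contMDiff := Ω.contMDiff_poissonBracket
  add_left f₁ f₂ h := by
    ext x
    simp only [Pi.add_apply, poissonBracket_apply, ContMDiffMap.coe_add]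
    rw [mvfderiv_add f₁.mdifferentiableAt f₂.mdifferentiableAt]
    rfl
  smul_left c f h := by
    ext x
    simp only [Pi.smul_apply, poissonBracket_apply, ContMDiffMap.coe_smul]
    have h1 : (c • (f : M → ℝ)) = (fun _ : M => c) • (f : M → ℝ) := by ext y; simp
    rw [h1, mvfderiv_smul mdifferentiableAt_const f.mdifferentiableAt]
    simp [mvfderiv_const]
  skew f h := by
    ext x
    exact Ω.poissonBracket_skew f h x
  leibniz f h k := by
    ext x
    simp only [Pi.add_apply, Pi.mul_apply]
    rw [poissonBracket_skew, poissonBracket_skew _ f h, poissonBracket_skew _ f k]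
    simp only [poissonBracket_apply, ContMDiffMap.coe_mul]
    rw [mvfderiv_mul h.mdifferentiableAt k.mdifferentiableAt]
    simp
    ring
  jacobi f h k := by
    ext x
    have hJ := 𝓐.d₂_of_hamiltonian Ω.form Ω.alternating (S := Ω.hamiltonianSection f)
      (T := Ω.hamiltonianSection h) (U := Ω.hamiltonianSection k)
      (fun x b => (Ω.form_hamiltonian f x b).symm) (fun x b => (Ω.form_hamiltonian h x b).symm)
      (fun x b => (Ω.form_hamiltonian k x b).symm) x
    rw [Ω.closed] at hJ
    let P : C^∞⟮𝓘(ℝ, E), M; ℝ⟯ → C^∞⟮𝓘(ℝ, E), M; ℝ⟯ → C^∞⟮𝓘(ℝ, E), M; ℝ⟯ :=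
      fun u v => ⟨Ω.poissonBracket u v, Ω.contMDiff_poissonBracket u v⟩
    change Ω.poissonBracket f (P h k) x + Ω.poissonBracket h (P k f) x +
      Ω.poissonBracket k (P f h) x = 0
    rw [poissonBracket_skew, poissonBracket_skew _ h, poissonBracket_skew _ k]
    simp only [poissonBracket_apply]
    rw [eq_comm, neg_add, neg_add] at hJ
    exact hJ

end SymplecticForm

/-! ### Linear algebra in the fibres -/

section Fibres

variable {E : Type*} [NormedAddCommGroup E] [NormedSpace ℝ E]
  {M : Type*} [TopologicalSpace M] [ChartedSpace E M] [IsManifold 𝓘(ℝ, E) ∞ M]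
  {V : Type*} [NormedAddCommGroup V] [NormedSpace ℝ V] [FiniteDimensional ℝ V]
  {A : M → Type*} [TopologicalSpace (TotalSpace V A)]
  [∀ x, AddCommGroup (A x)] [∀ x, Module ℝ (A x)] [∀ x, TopologicalSpace (A x)]
  [∀ x, IsTopologicalAddGroup (A x)] [∀ x, ContinuousConstSMul ℝ (A x)]
  [FiberBundle V A] [VectorBundle ℝ V A]
  {𝓐 : LieAlgebroid E V A}

namespace SymplecticForm

variable (Ω : SymplecticForm 𝓐)

theorem orth_orth (x : M) (W : Submodule ℝ (A x)) : Ω.orth x (Ω.orth x W) = W := by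
  have : FiniteDimensional ℝ (A x) := VectorBundle.finiteDimensional ℝ V A x
  have horth : ∀ W, Ω.orth x W = LinearMap.BilinForm.orthogonal (Ω.formₗ x) W := by
    intro W
    ext a
    refine forall₂_congr fun b _ => ?_
    rw [Ω.skew, neg_eq_zero]
    rfl
  have hrefl : LinearMap.BilinForm.IsRefl (Ω.formₗ x) := fun a b h => by
    have := Ω.skew x b a
    exact this.trans (neg_eq_zero.2 h)
  rw [horth, horth]
  refine LinearMap.BilinForm.orthogonal_orthogonal ⟨fun a ha => ?_, fun a ha => ?_⟩ hrefl W
  · exact Ω.nondegenerate x a ha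
  · exact Ω.nondegenerate x a fun b => hrefl _ _ (ha b)

/-- Vectors orthogonal to the isotropy are those that are dual to covectors on the base. -/
theorem exists_of_mem_orth_L {x : M} {a : A x} (ha : a ∈ Ω.orth x (𝓐.L x)) :
    ∃ ξ : TangentSpace 𝓘(ℝ, E) x →ₗ[ℝ] ℝ, ∀ b, Ω.form x a b = ξ (𝓐.anchor x b) := by
  have h : Ω.formₗ x a ∈ LinearMap.range (𝓐.anchor x).toLinearMap.dualMap := by
    rw [LinearMap.range_dualMap_eq_dualAnnihilator_ker, Submodule.mem_dualAnnihilator]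
    exact ha
  obtain ⟨ξ, hξ⟩ := h
  exact ⟨ξ, fun b => (LinearMap.congr_fun hξ b).symm⟩

theorem hamiltonian_mem_orth_L (f : C^∞⟮𝓘(ℝ, E), M; ℝ⟯) (x : M) :
    Ω.hamiltonian f x ∈ Ω.orth x (𝓐.L x) := by
  intro b hb
  rw [Ω.form_hamiltonian, LieAlgebroid.d₀, ContinuousLinearMap.comp_apply,
    show 𝓐.anchor x b = 0 from hb, map_zero]

end SymplecticForm

namespace CompatibleTriple

variable (τ : CompatibleTriple 𝓐)

/-- Orthogonal projection with respect to the metric. -/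
theorem exists_sub_orthogonal (x : M) (W : Submodule ℝ (A x)) (a : A x) :
    ∃ w ∈ W, ∀ w' ∈ W, τ.g.inner x (a - w) w' = 0 := by
  have : FiniteDimensional ℝ (A x) := VectorBundle.finiteDimensional ℝ V A x
  let B : A x →ₗ[ℝ] Module.Dual ℝ W :=
    { toFun := fun a => (τ.g.inner x a).toLinearMap.comp W.subtype
      map_add' := fun a b => by ext; simp
      map_smul' := fun c a => by ext; simp }
  have hinj : Function.Injective (B.comp W.subtype) := by
    rw [injective_iff_map_eq_zero]
    intro w hw
    by_contra hne
    have h1 := τ.g.pos x w fun h => hne (Subtype.ext h)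
    have h2 : τ.g.inner x w w = 0 := LinearMap.congr_fun hw w
    exact h1.ne' h2
  have hsurj : Function.Surjective (B.comp W.subtype) :=
    (LinearMap.injective_iff_surjective_of_finrank_eq_finrank
      (Subspace.dual_finrank_eq (K := ℝ) (V := W)).symm).1 hinj
  obtain ⟨w, hw⟩ := hsurj (B a)
  refine ⟨w, w.2, fun w' hw' => ?_⟩
  have h : τ.g.inner x w w' = τ.g.inner x a w' := LinearMap.congr_fun hw ⟨w', hw'⟩
  simp [h]

theorem form_J (x : M) (a b : A x) : τ.Ω.form x a (τ.J x b) = -τ.g.inner x a b := by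
  rw [τ.Ω_eq, τ.J_J, map_neg]

theorem eq_zero_of_inner_self {x : M} {a : A x} (h : τ.g.inner x a a = 0) : a = 0 := by
  by_contra hne
  exact (τ.g.pos x a hne).ne' h

/-- As `Ω(a, J l) = -g(a, l)`, being `Ω`-orthogonal to `E¹ = J(L¹)` is the same as being
`g`-orthogonal to `L¹`. -/
theorem mem_E₂ {x : M} {a : A x} :
    a ∈ τ.E₂ x ↔ a ∈ τ.Ω.orth x (𝓐.L x) ∧ ∀ l ∈ τ.L₁ x, τ.g.inner x a l = 0 := by
  constructor
  · intro h
    refine ⟨fun b hb => h b (Submodule.mem_sup_left hb), fun l hl => ?_⟩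
    rw [← neg_eq_zero, ← τ.form_J]
    exact h _ (Submodule.mem_sup_right ⟨l, hl, rfl⟩)
  · rintro ⟨h1, h2⟩ b hb
    obtain ⟨l, hl, c, ⟨m, hm, rfl⟩, rfl⟩ := Submodule.mem_sup.1 hb
    have := τ.form_J x a m
    rw [map_add, h1 l hl, zero_add]
    exact this.trans (by rw [h2 m hm, neg_zero])

/-- This is the `g`-orthogonal splitting of `L^Ω` along its subspace `L¹`. -/
theorem E₂_sup_L₁ (x : M) : τ.E₂ x ⊔ τ.L₁ x = τ.Ω.orth x (𝓐.L x) := by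
  refine le_antisymm (sup_le (fun a ha => (τ.mem_E₂.1 ha).1) inf_le_right) fun a ha => ?_
  obtain ⟨w, hw, h⟩ := τ.exists_sub_orthogonal x (τ.L₁ x) a
  refine Submodule.mem_sup.2 ⟨a - w, τ.mem_E₂.2 ⟨sub_mem ha hw.2, h⟩, w, hw, by simp⟩

theorem L₁_sup_L₂ (x : M) : τ.L₁ x ⊔ τ.L₂ x = 𝓐.L x := by
  refine le_antisymm (sup_le inf_le_left fun a ha => ha.1) fun a ha => ?_
  obtain ⟨w, hw, h⟩ := τ.exists_sub_orthogonal x (τ.L₁ x) a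
  exact Submodule.mem_sup.2 ⟨w, hw, a - w, ⟨sub_mem ha hw.1, h⟩, by simp⟩

/-- If `J l + e` lies in `L`, pairing it with `l ∈ L^Ω` gives `g(l, l) = 0`; then `e ∈ L ∩ E²` lies
in `L¹` and is `g`-orthogonal to it, so `e = 0`. For spanning, a vector `Ω`-orthogonal to the sum
lies in `E²`, and in `(L^Ω)^Ω = L`; it is therefore again in `L¹` and `g`-orthogonal to `L¹`. -/
theorem isCompl_E_L (x : M) : IsCompl (τ.E₁ x ⊔ τ.E₂ x) (τ.L₁ x ⊔ τ.L₂ x) := by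
  rw [τ.L₁_sup_L₂]
  constructor
  · rw [Submodule.disjoint_def]
    intro a ha haL
    obtain ⟨_, ⟨l, hl, rfl⟩, e, he, rfl⟩ := Submodule.mem_sup.1 ha
    have he' := τ.mem_E₂.1 he
    have h1 : τ.Ω.form x l (τ.J x l + e) = 0 := hl.2 _ haL
    have h2 : τ.Ω.form x l e = 0 := by rw [τ.Ω.skew, he'.1 l hl.1, neg_zero]
    rw [map_add, h2, add_zero, τ.form_J, neg_eq_zero] at h1
    have hl0 := τ.eq_zero_of_inner_self h1
    subst hl0
    have heL : e ∈ 𝓐.L x := by simpa using haL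
    have he0 := τ.eq_zero_of_inner_self (he'.2 e ⟨heL, he'.1⟩)
    simp [he0]
  · rw [codisjoint_iff]
    set W := τ.E₁ x ⊔ τ.E₂ x ⊔ 𝓐.L x with hW
    have hbot : τ.Ω.orth x W = ⊥ := by
      rw [eq_bot_iff]
      intro a ha
      have haL : a ∈ τ.Ω.orth x (𝓐.L x) := fun b hb => ha b (Submodule.mem_sup_right hb)
      have haE₂ : a ∈ τ.E₂ x := fun b hb => ha b ((sup_le le_sup_right
        (le_sup_left.trans le_sup_left) : 𝓐.L x ⊔ τ.E₁ x ≤ W) hb)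
      have haLL : a ∈ 𝓐.L x := by
        rw [← τ.Ω.orth_orth x (𝓐.L x), ← τ.E₂_sup_L₁]
        refine fun b hb => ha b ((sup_le (le_sup_right.trans le_sup_left)
          (inf_le_left.trans le_sup_right) : τ.E₂ x ⊔ τ.L₁ x ≤ W) hb)
      exact τ.eq_zero_of_inner_self ((τ.mem_E₂.1 haE₂).2 a ⟨haLL, haL⟩)
    rw [← τ.Ω.orth_orth x W, hbot, eq_top_iff]
    intro a _ b hb
    rw [(Submodule.mem_bot ℝ).1 hb, map_zero]

theorem mem_Λ {x : M} {v : TangentSpace 𝓘(ℝ, E) x} :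
    v ∈ τ.Λ x ↔ ∃ a ∈ τ.Ω.orth x (𝓐.L x), 𝓐.anchor x a = v := by
  rw [CompatibleTriple.Λ, τ.E₂_sup_L₁]
  rfl

end CompatibleTriple

end Fibres

/-! ### Superposition operators and integral equations on path spaces -/

section PathSpace

set_option synthInstance.maxHeartbeats 200000
set_option maxHeartbeats 400000

open Set Filter Topology unitInterval

universe u

variable {K : Type*} [TopologicalSpace K] [CompactSpace K]
  {E F : Type u} [NormedAddCommGroup E] [NormedSpace ℝ E] [NormedAddCommGroup F] [NormedSpace ℝ F]

namespace ContinuousMap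

variable (K E F) in
/-- Pointwise application of a family of continuous linear maps. -/
noncomputable def clmApply : C(K, E →L[ℝ] F) →L[ℝ] C(K, E) →L[ℝ] C(K, F) :=
  LinearMap.mkContinuous₂
    (LinearMap.mk₂ ℝ
      (fun (T : C(K, E →L[ℝ] F)) (u : C(K, E)) => (⟨fun s => T s (u s), by fun_prop⟩ : C(K, F)))
      (fun _ _ _ => by ext; simp) (fun _ _ _ => by ext; simp) (fun _ _ _ => by ext; simp)
      (fun _ _ _ => by ext; simp)) 1 (fun T u => by
    rw [one_mul, ContinuousMap.norm_le _ (by positivity)]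
    intro s
    exact ((T s).le_opNorm _).trans (mul_le_mul (T.norm_coe_le_norm s) (u.norm_coe_le_norm s)
      (norm_nonneg _) ((norm_nonneg _).trans (T.norm_coe_le_norm s))))

theorem contDiff_clmApply {n : ℕ∞ω} : ContDiff ℝ n (clmApply K E F) := by
  fun_prop

@[simp]
theorem clmApply_apply (T : C(K, E →L[ℝ] F)) (u : C(K, E)) (s : K) :
    clmApply K E F T u s = T s (u s) := rfl

variable (K E) in
/-- The constant maps. -/
noncomputable def constCLM : E →L[ℝ] C(K, E) :=
  LinearMap.mkContinuous
    { toFun := fun x => ContinuousMap.const K x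
      map_add' := fun _ _ => rfl
      map_smul' := fun _ _ => rfl } 1 (fun x => by
    rw [one_mul, ContinuousMap.norm_le _ (by positivity)]
    intro s
    rfl)

@[simp]
theorem constCLM_apply (x : E) (s : K) : constCLM K E x s = x := rfl

/-- The image of `γ` is compact, so `f'` varies by at most `ε` on balls of one radius `δ` around all
its points. The mean value inequality on these balls bounds the remainder uniformly in `s`. -/
theorem hasFDerivAt_comp_left {f : E → F} {f' : E → E →L[ℝ] F} (hf : ∀ x, HasFDerivAt f (f' x) x)
    (hc : Continuous f) (hc' : Continuous f') (γ : C(K, E)) :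
    HasFDerivAt (fun γ : C(K, E) => (⟨f, hc⟩ : C(E, F)).comp γ)
      (clmApply K E F ((⟨f', hc'⟩ : C(E, E →L[ℝ] F)).comp γ)) γ := by
  rw [hasFDerivAt_iff_isLittleO, Asymptotics.isLittleO_iff]
  intro ε hε
  have hunif := (isCompact_range γ.continuous).uniformContinuousAt_of_continuousAt f'
    (fun a _ => hc'.continuousAt) (Metric.dist_mem_uniformity hε)
  obtain ⟨δ, hδ, hsub⟩ := Metric.mem_uniformity_dist.1 hunif
  filter_upwards [Metric.ball_mem_nhds γ hδ] with γ' hγ'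
  rw [ContinuousMap.norm_le _ (by positivity)]
  intro s
  have hd : dist (γ' s) (γ s) < δ := (ContinuousMap.dist_apply_le_dist s).trans_lt hγ'
  have hmv := (convex_ball (γ s) δ).norm_image_sub_le_of_norm_hasFDerivWithin_le'
    (f := f) (f' := f') (φ := f' (γ s)) (C := ε) (x := γ s) (y := γ' s)
    (fun z _ => (hf z).hasFDerivWithinAt) (fun z hz => by
      have h := hsub (a := γ s) (b := z) (by rwa [dist_comm, ← Metric.mem_ball]) ⟨s, rfl⟩
      rw [← dist_eq_norm, dist_comm]
      exact le_of_lt h) (Metric.mem_ball_self hδ) (by simpa using hd)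
  refine hmv.trans ?_
  gcongr
  exact (γ' - γ).norm_coe_le_norm s

/-- The derivative of `γ ↦ f ∘ γ` is the same operator for `f'`, followed by the bounded linear
`clmApply`. The induction thus passes from `F` to `E →L[ℝ] F`, which is why the target is quantified
and shares a universe with `E`. -/
theorem contDiff_nat_comp_left (n : ℕ) : ∀ {F : Type u} [NormedAddCommGroup F] [NormedSpace ℝ F]
    {f : E → F} (hf : ContDiff ℝ n f),
    ContDiff ℝ n (fun γ : C(K, E) => (⟨f, hf.continuous⟩ : C(E, F)).comp γ) := by
  induction n with
  | zero =>
    intro F _ _ f hf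
    exact contDiff_zero.2 (ContinuousMap.continuous_postcomp _)
  | succ n ih =>
    intro F _ _ f hf
    push_cast at hf ⊢
    obtain ⟨f', hf', h⟩ := contDiff_succ_iff_hasFDerivAt.1 hf
    refine contDiff_succ_iff_hasFDerivAt.2 ⟨_, ?_, fun γ =>
      hasFDerivAt_comp_left h _ hf'.continuous γ⟩
    exact contDiff_clmApply.comp (ih hf')

theorem contDiff_comp_left {f : E → F} (hf : ContDiff ℝ ∞ f) :
    ContDiff ℝ ∞ (fun γ : C(K, E) => (⟨f, hf.continuous⟩ : C(E, F)).comp γ) :=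
  contDiff_infty.2 fun n => contDiff_nat_comp_left n (hf.of_le (by exact_mod_cast le_top))

end ContinuousMap

section Primitive

variable (E) [CompleteSpace E]

/-- The primitive vanishing at `0` of a continuous path. -/
noncomputable def pathPrimitive : C(I, E) →L[ℝ] C(I, E) :=
  LinearMap.mkContinuous
    { toFun := fun u => ⟨fun s => ∫ r in (0 : ℝ)..s, u (projIcc 0 1 zero_le_one r), by
        have h : Continuous fun r : ℝ => u (projIcc 0 1 zero_le_one r) :=
          u.continuous.comp continuous_projIcc
        exact (intervalIntegral.continuous_primitive (fun a b => h.intervalIntegrable a b) 0).comp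
          continuous_subtype_val⟩
      map_add' := fun u v => by
        ext s
        have h : ∀ u : C(I, E), Continuous fun r : ℝ => u (projIcc 0 1 zero_le_one r) :=
          fun u => u.continuous.comp continuous_projIcc
        exact intervalIntegral.integral_add ((h u).intervalIntegrable _ _)
          ((h v).intervalIntegrable _ _)
      map_smul' := fun c u => by
        ext s
        exact intervalIntegral.integral_smul c _ } 1 (fun u => by
    rw [one_mul, ContinuousMap.norm_le _ (by positivity)]
    intro s
    have h := intervalIntegral.norm_integral_le_of_norm_le_const (a := (0 : ℝ)) (b := s)
      (f := fun r => u (projIcc 0 1 zero_le_one r)) (C := ‖u‖) fun r _ => u.norm_coe_le_norm _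
    refine h.trans ?_
    rw [sub_zero, abs_of_nonneg s.2.1]
    exact mul_le_of_le_one_right (norm_nonneg _) s.2.2)

variable {E}

theorem pathPrimitive_zero (u : C(I, E)) : pathPrimitive E u 0 = 0 :=
  intervalIntegral.integral_same

theorem pathPrimitive_constCLM (x : E) : pathPrimitive E (ContinuousMap.constCLM I E x) 1 = x := by
  change ∫ r in (0 : ℝ)..(1 : ℝ), x = x
  simp

theorem hasDerivWithinAt_of_eq_primitive {γ u : C(I, E)} {c : E}
    (h : γ = ContinuousMap.constCLM I E c + pathPrimitive E u) {s : ℝ} (hs : s ∈ Icc (0 : ℝ) 1) :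
    HasDerivWithinAt (fun s => γ (projIcc 0 1 zero_le_one s)) (u (projIcc 0 1 zero_le_one s))
      (Icc 0 1) s := by
  have hu : Continuous fun r : ℝ => u (projIcc 0 1 zero_le_one r) :=
    u.continuous.comp continuous_projIcc
  have h1 := ((intervalIntegral.integral_hasDerivAt_right (hu.intervalIntegrable 0 s)
    (hu.stronglyMeasurableAtFilter _ _) hu.continuousAt).const_add c).hasDerivWithinAt (s := Icc 0 1)
  refine h1.congr_of_mem (fun t ht => ?_) hs
  rw [h]
  change c + ∫ r in (0 : ℝ)..(projIcc 0 1 zero_le_one t : ℝ), _ = _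
  rw [projIcc_of_mem _ ht]

end Primitive

section Family

variable [CompleteSpace E] [CompleteSpace F]

open ContinuousMap

/-- Solutions of `γ' = B(γ) ξ` with fixed initial value depend smoothly on the parameter `ξ` near
`0`. -/
theorem exists_contDiffAt_solutions {B : E → F →L[ℝ] E} (hB : ContDiff ℝ ∞ B) (x₀ : E) :
    ∃ Γ : F → C(I, E), Γ 0 = constCLM I E x₀ ∧ ∀ᶠ ξ in 𝓝 (0 : F), ContDiffAt ℝ ∞ Γ ξ ∧
      Γ ξ = constCLM I E x₀ + pathPrimitive E
        (clmApply I F E ((⟨B, hB.continuous⟩ : C(E, F →L[ℝ] E)).comp (Γ ξ)) (constCLM I F ξ)) := by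
  let N : C(I, E) → C(I, F →L[ℝ] E) := fun γ => (⟨B, hB.continuous⟩ : C(E, F →L[ℝ] E)).comp γ
  have hN : ContDiff ℝ ∞ N := contDiff_comp_left hB
  have hA : ContDiff ℝ ∞ (fun p : F × C(I, E) => clmApply I F E (N p.2)) :=
    contDiff_clmApply.comp (hN.comp contDiff_snd)
  let Q : F × C(I, E) → C(I, E) := fun p =>
    pathPrimitive E (clmApply I F E (N p.2) (constCLM I F p.1))
  have hQ : ContDiff ℝ ∞ Q := by
    exact (pathPrimitive E).contDiff.comp
      (hA.clm_apply ((constCLM I F).contDiff.comp contDiff_fst))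
  -- Solutions are the points with `H (ξ, γ) = (ξ, 0)`. The constant path at `ξ = 0` is one of them.
  -- There `Q` has no derivative in `γ`, being linear in `ξ`, so `H` has the triangular, invertible
  -- differential `(ξ, u) ↦ (ξ, u - k ξ)`.
  let H : F × C(I, E) → F × C(I, E) := fun p => (p.1, p.2 - constCLM I E x₀ - Q p)
  have hH : ContDiff ℝ ∞ H := by
    refine contDiff_fst.prodMk ((contDiff_snd.sub contDiff_const).sub hQ)
  let p₀ : F × C(I, E) := (0, constCLM I E x₀)
  let k : F →L[ℝ] C(I, E) := (pathPrimitive E).comp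
    ((clmApply I F E (N (constCLM I E x₀))).comp (constCLM I F))
  have hQ' : HasFDerivAt Q (k.comp (ContinuousLinearMap.fst ℝ F C(I, E))) p₀ := by
    have hN' : HasFDerivAt (fun p : F × C(I, E) => clmApply I F E (N p.2))
        (fderiv ℝ (fun p : F × C(I, E) => clmApply I F E (N p.2)) p₀) p₀ :=
      (hA.differentiable (by simp) p₀).hasFDerivAt
    have hc' : HasFDerivAt (fun p : F × C(I, E) => constCLM I F p.1)
        ((constCLM I F).comp (ContinuousLinearMap.fst ℝ F C(I, E))) p₀ :=
      ((constCLM I F).comp (ContinuousLinearMap.fst ℝ F C(I, E))).hasFDerivAt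
    have h := (pathPrimitive E).hasFDerivAt.comp p₀ (hN'.clm_apply hc')
    refine h.congr_fderiv ?_
    refine ContinuousLinearMap.ext fun q => ?_
    simp [k, p₀]
  let e : (F × C(I, E)) ≃L[ℝ] (F × C(I, E)) := ContinuousLinearEquiv.equivOfInverse
    ((ContinuousLinearMap.fst ℝ F C(I, E)).prod (ContinuousLinearMap.snd ℝ F C(I, E) -
      k.comp (ContinuousLinearMap.fst ℝ F C(I, E))))
    ((ContinuousLinearMap.fst ℝ F C(I, E)).prod (ContinuousLinearMap.snd ℝ F C(I, E) +
      k.comp (ContinuousLinearMap.fst ℝ F C(I, E))))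
    (fun q => by simp) (fun q => by simp)
  have hH' : HasFDerivAt H (e : F × C(I, E) →L[ℝ] F × C(I, E)) p₀ :=
    hasFDerivAt_fst.prodMk ((hasFDerivAt_snd.sub_const _).sub hQ')
  let Φ := hH.contDiffAt.toOpenPartialHomeomorph H hH' (by simp)
  have hΦ : ⇑Φ = H := rfl
  have hp₀ : p₀ ∈ Φ.source := hH.contDiffAt.mem_toOpenPartialHomeomorph_source hH' (by simp)
  have hHp₀ : H p₀ = (0, 0) := by
    simp [H, Q, p₀]
  have h0t : ((0 : F), (0 : C(I, E))) ∈ Φ.target := by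
    rw [← hHp₀]; exact Φ.map_source hp₀
  have hsymm0 : Φ.symm (0, 0) = p₀ := by
    rw [← hHp₀]; exact Φ.left_inv hp₀
  refine ⟨fun ξ => (Φ.symm (ξ, 0)).2, congrArg Prod.snd hsymm0, ?_⟩
  have hcont : ContinuousAt (fun ξ : F => ((ξ, 0) : F × C(I, E))) 0 := by fun_prop
  have hsc : ContinuousAt Φ.symm (0, 0) := Φ.continuousAt_symm h0t
  -- Smoothness of the local inverse at each nearby point requires the differential of `H` to be
  -- invertible at its preimage; this is an open condition.
  have hinv : ∀ᶠ q in 𝓝 ((0 : F), (0 : C(I, E))), fderiv ℝ H (Φ.symm q) ∈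
      Set.range ((↑) : ((F × C(I, E)) ≃L[ℝ] (F × C(I, E))) → _) := by
    have h1 : ContinuousAt (fun q => fderiv ℝ H (Φ.symm q)) (0, 0) :=
      ContinuousAt.comp (g := fderiv ℝ H) (hH.continuous_fderiv (by simp)).continuousAt hsc
    refine h1.eventually ?_
    change ∀ᶠ y in 𝓝 (fderiv ℝ H (Φ.symm (0, 0))), _
    rw [hsymm0, hH'.fderiv]
    exact ContinuousLinearEquiv.nhds e
  filter_upwards [hcont.eventually hinv, hcont.eventually (Φ.open_target.mem_nhds h0t)]
    with ξ ⟨e', he'⟩ hξ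
  constructor
  · have hs := Φ.contDiffAt_symm (n := ∞) hξ (f₀' := e')
      (by rw [he', hΦ]; exact (hH.differentiable (by simp) _).hasFDerivAt) hH.contDiffAt
    exact contDiffAt_snd.comp ξ (hs.comp ξ (contDiffAt_id.prodMk contDiffAt_const))
  · have hr : H (Φ.symm (ξ, 0)) = (ξ, 0) := Φ.right_inv hξ
    have hr1 : (Φ.symm (ξ, 0)).1 = ξ := congrArg Prod.fst hr
    have hr2 := congrArg Prod.snd hr
    simp only [H, Q, hr1] at hr2
    rw [sub_eq_zero, sub_eq_iff_eq_add'] at hr2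
    exact hr2

end Family

end PathSpace

section PathSpace

set_option synthInstance.maxHeartbeats 200000
set_option maxHeartbeats 400000

open Set Filter Topology unitInterval ContinuousMap

universe u

variable {E F : Type u} [NormedAddCommGroup E] [NormedSpace ℝ E] [CompleteSpace E]
  [NormedAddCommGroup F] [NormedSpace ℝ F]

/-- The derivative of a family of solutions of `γ' = B(γ) ξ` in the parameter solves the
linearized equation. -/
theorem fderiv_solutions_eq_primitive {B : E → F →L[ℝ] E} (hB : ContDiff ℝ ∞ B) {x₀ : E}
    {Γ : F → C(I, E)} {Γ' : F →L[ℝ] C(I, E)} {ξ : F} (hΓ : HasFDerivAt Γ Γ' ξ)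
    (heq : ∀ᶠ ξ in 𝓝 ξ, Γ ξ = constCLM I E x₀ + pathPrimitive E
        (clmApply I F E ((⟨B, hB.continuous⟩ : C(E, F →L[ℝ] E)).comp (Γ ξ)) (constCLM I F ξ)))
    (η : F) :
    ∃ u : C(I, E), Γ' η = constCLM I E 0 + pathPrimitive E u ∧
      ∀ s, u s = fderiv ℝ B (Γ ξ s) (Γ' η s) ξ + B (Γ ξ s) η := by
  have hB' : Continuous (fderiv ℝ B) := hB.continuous_fderiv (by simp)
  have h1 : HasFDerivAt (fun ξ => (⟨B, hB.continuous⟩ : C(E, F →L[ℝ] E)).comp (Γ ξ)) _ ξ :=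
    (hasFDerivAt_comp_left (fun x => (hB.differentiable (by simp) x).hasFDerivAt)
      hB.continuous hB' (Γ ξ)).comp ξ hΓ
  have h2 : HasFDerivAt (fun ξ => clmApply I F E
      ((⟨B, hB.continuous⟩ : C(E, F →L[ℝ] E)).comp (Γ ξ))) _ ξ :=
    HasFDerivAt.comp (g := clmApply I F E) ξ (ContinuousLinearMap.hasFDerivAt _) h1
  have h3 := ((pathPrimitive E).hasFDerivAt.comp ξ
    (h2.clm_apply (constCLM I F).hasFDerivAt)).const_add (constCLM I E x₀)
  -- Both sides of the integral equation are differentiated in the parameter.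
  have h4 := (hΓ.congr_of_eventuallyEq (heq.mono fun _ h => h.symm)).unique h3
  have h5 := DFunLike.congr_fun h4 η
  refine ⟨clmApply I F E (clmApply I E (F →L[ℝ] E)
      ((⟨fderiv ℝ B, hB'⟩ : C(E, E →L[ℝ] F →L[ℝ] E)).comp (Γ ξ)) (Γ' η)) (constCLM I F ξ) +
    clmApply I F E ((⟨B, hB.continuous⟩ : C(E, F →L[ℝ] E)).comp (Γ ξ)) (constCLM I F η), ?_,
    fun s => rfl⟩
  rw [map_zero, zero_add, add_comm]
  exact h5

end PathSpace

/-! ### Affine differential equations on the unit interval -/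

section LinearODE

open Set Filter Topology

variable {G : Type*} [NormedAddCommGroup G] [NormedSpace ℝ G]

theorem exists_solution_affine_ode [CompleteSpace G] {A : ℝ → G →L[ℝ] G} {b : ℝ → G} {c : ℝ}
    (hA : ContinuousOn A (Icc 0 1)) (hb : ContinuousOn b (Icc 0 1))
    (hA2 : ∀ s ∈ Icc (0 : ℝ) 1, ‖A s‖ ≤ 1 / 2) (hbc : ∀ s ∈ Icc (0 : ℝ) 1, ‖b s‖ ≤ c) (y₀ : G) :
    ∃ y : ℝ → G, y 0 = y₀ ∧
      ∀ s ∈ Icc (0 : ℝ) 1, HasDerivWithinAt y (A s (y s) + b s) (Icc 0 1) s := by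
  have hc : 0 ≤ c := (norm_nonneg _).trans (hbc 0 (by simp))
  -- On the ball of radius `a` about `y₀` the speed is at most `(‖y₀‖ + a) / 2 + c = a`, so one
  -- Picard–Lindelöf step covers all of `[0, 1]`.
  let a : NNReal := ⟨‖y₀‖ + 2 * c, by positivity⟩
  have hPL : IsPicardLindelof (fun s y => A s y + b s) (⟨0, by simp⟩ : Icc (0 : ℝ) 1) y₀ a 0 a
      1 := by
    refine ⟨fun s hs => ?_, fun y _ => (hA.clm_apply continuousOn_const).add hb,
      fun s hs y hy => ?_, ?_⟩
    · refine (LipschitzWith.of_dist_le_mul fun y z => ?_).lipschitzOnWith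
      rw [dist_add_right, dist_eq_norm, dist_eq_norm, ← map_sub, NNReal.coe_one, one_mul]
      refine ((A s).le_of_opNorm_le (hA2 s hs) _).trans ?_
      linarith [norm_nonneg (y - z)]
    · have h1 : ‖y‖ ≤ ‖y₀‖ + (‖y₀‖ + 2 * c) := by
        have h2 : ‖y - y₀‖ ≤ ‖y₀‖ + 2 * c := by rw [← dist_eq_norm]; exact hy
        linarith [norm_le_norm_add_norm_sub' y y₀]
      have h3 := (A s).le_of_opNorm_le (hA2 s hs) y
      have h4 := norm_add_le (A s y) (b s)
      have h5 := hbc s hs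
      change ‖A s y + b s‖ ≤ ‖y₀‖ + 2 * c
      linarith
    · simp
  exact hPL.exists_eq_forall_mem_Icc_hasDerivWithinAt₀

theorem eq_zero_of_norm_deriv_le {w w' : ℝ → G} {K : ℝ}
    (hw : ∀ s ∈ Icc (0 : ℝ) 1, HasDerivWithinAt w (w' s) (Icc 0 1) s)
    (hK : ∀ s ∈ Icc (0 : ℝ) 1, ‖w' s‖ ≤ K * ‖w s‖) (h0 : w 0 = 0) : w 1 = 0 :=
  eq_zero_of_abs_deriv_le_mul_abs_self_of_eq_zero_right
    (fun s hs => (hw s hs).continuousWithinAt)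
    (fun s hs => (hw s ⟨hs.1, hs.2.le⟩).mono_of_mem_nhdsWithin (Icc_mem_nhdsGE_of_mem hs)) h0
    (fun s hs => hK s ⟨hs.1, hs.2.le⟩) 1 (by simp)

end LinearODE

/-! ### Transport of a Poisson tensor along Hamiltonian curves -/

section PoissonTransport

open Set Filter Topology

variable {E : Type*} [NormedAddCommGroup E] [NormedSpace ℝ E]
  {F : Type*} [NormedAddCommGroup F] [NormedSpace ℝ F] [CompleteSpace F]
  {B : E → F →L[ℝ] E} {D : (E →L[ℝ] E) →L[ℝ] F →L[ℝ] F} {γ : ℝ → E} {ξ : F}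

theorem continuousOn_flip_fderiv (hB : ContDiff ℝ ∞ B) {s : Set ℝ} (hγ : ContinuousOn γ s)
    (ξ : F) : ContinuousOn (fun s => (fderiv ℝ B (γ s)).flip ξ) s := by
  have h1 : ContinuousOn (fun s => fderiv ℝ B (γ s)) s :=
    (hB.continuous_fderiv (by simp)).comp_continuousOn hγ
  have h2 : Continuous fun T : E →L[ℝ] F →L[ℝ] E => T.flip ξ :=
    (ContinuousLinearMap.flipₗᵢ ℝ E F E).continuous.clm_apply continuous_const
  exact h2.comp_continuousOn h1

/-- Let `B` be a family of linear maps satisfying the Jacobi identity with respect to a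
transposition `D` of endomorphisms. Solutions of the linearized Hamiltonian equation along an
integral curve `γ` of `B ξ` stay in the range of `B`. -/
theorem exists_eq_apply_of_linearized (hB : ContDiff ℝ ∞ B) (hD : ∀ T, ‖D T‖ ≤ ‖T‖)
    (hγ : ∀ s ∈ Icc (0 : ℝ) 1, HasDerivWithinAt γ (B (γ s) ξ) (Icc 0 1) s)
    (hJ : ∀ s ∈ Icc (0 : ℝ) 1, ∀ ζ, fderiv ℝ B (γ s) (B (γ s) ξ) ζ =
      fderiv ℝ B (γ s) (B (γ s) ζ) ξ + B (γ s) (D ((fderiv ℝ B (γ s)).flip ξ) ζ))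
    (hA : ∀ s ∈ Icc (0 : ℝ) 1, ‖(fderiv ℝ B (γ s)).flip ξ‖ ≤ 1 / 2)
    {ψ : ℝ → E} {η : F} (hψ0 : ψ 0 = 0)
    (hψ : ∀ s ∈ Icc (0 : ℝ) 1,
      HasDerivWithinAt ψ (fderiv ℝ B (γ s) (ψ s) ξ + B (γ s) η) (Icc 0 1) s) :
    ∃ α, ψ 1 = B (γ 1) α := by
  have hDc := continuousOn_flip_fderiv hB (fun s hs => (hγ s hs).continuousWithinAt) ξ
  -- Put `A = (fderiv ℝ B γ).flip ξ` and solve `α' = -D(A) α + η` with `α(0) = 0`. By `hJ`, `B(γ) α`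
  -- then satisfies the same linearized equation as `ψ`, so `w = ψ - B(γ) α` solves `w' = A w` with
  -- `w(0) = 0`.
  obtain ⟨α, hα0, hα⟩ := exists_solution_affine_ode
    (A := fun s => -D ((fderiv ℝ B (γ s)).flip ξ)) (b := fun _ => η) (c := ‖η‖)
    (D.continuous.comp_continuousOn hDc).neg continuousOn_const
    (fun s hs => by rw [norm_neg]; exact (hD _).trans (hA s hs))
    (fun _ _ => le_rfl) 0
  refine ⟨α 1, ?_⟩
  have hBγ : ∀ s ∈ Icc (0 : ℝ) 1, HasDerivWithinAt (fun s => B (γ s))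
      (fderiv ℝ B (γ s) (B (γ s) ξ)) (Icc 0 1) s := fun s hs =>
    (hB.differentiable (by simp) (γ s)).hasFDerivAt.comp_hasDerivWithinAt s (hγ s hs)
  have h := eq_zero_of_norm_deriv_le (w := fun s => ψ s - B (γ s) (α s))
    (w' := fun s => (fderiv ℝ B (γ s)).flip ξ (ψ s - B (γ s) (α s))) (K := 1 / 2)
    (fun s hs => by
      refine ((hψ s hs).sub ((hBγ s hs).clm_apply (hα s hs))).congr_deriv ?_
      have hJs := hJ s hs (α s)
      simp only [ContinuousLinearMap.flip_apply, map_sub, map_add, neg_apply, map_neg,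
        sub_apply, hJs]
      abel)
    (fun s hs => ContinuousLinearMap.le_of_opNorm_le _ (hA s hs) _)
    (by simp [hψ0, hα0])
  exact sub_eq_zero.1 h

variable [CompleteSpace E]

/-- Under the same identity, `B` is transported along integral curves of `B ξ` by conjugation. -/
theorem exists_conj_of_hamiltonian_flow (hB : ContDiff ℝ ∞ B) (hD : ∀ T, ‖D T‖ ≤ ‖T‖)
    (hD_id : D (ContinuousLinearMap.id ℝ E) = ContinuousLinearMap.id ℝ F)
    (hD_comp : ∀ S T : E →L[ℝ] E, D (S.comp T) = (D T).comp (D S))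
    (hγ : ∀ s ∈ Icc (0 : ℝ) 1, HasDerivWithinAt γ (B (γ s) ξ) (Icc 0 1) s)
    (hJ : ∀ s ∈ Icc (0 : ℝ) 1, ∀ ζ, fderiv ℝ B (γ s) (B (γ s) ξ) ζ =
      fderiv ℝ B (γ s) (B (γ s) ζ) ξ + B (γ s) (D ((fderiv ℝ B (γ s)).flip ξ) ζ))
    (hA : ∀ s ∈ Icc (0 : ℝ) 1, ‖(fderiv ℝ B (γ s)).flip ξ‖ ≤ 1 / 2) :
    ∃ Q : E →L[ℝ] E, B (γ 1) = (Q.comp (B (γ 0))).comp (D Q) := by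
  have hDc := continuousOn_flip_fderiv hB (fun s hs => (hγ s hs).continuousWithinAt) ξ
  set A : ℝ → E →L[ℝ] E := fun s => (fderiv ℝ B (γ s)).flip ξ with hAdef
  -- `Q` is the linearized flow: `Q' = A Q`, `Q(0) = id`.
  obtain ⟨Q, hQ0, hQ⟩ := exists_solution_affine_ode
    (A := fun s => ContinuousLinearMap.compL ℝ E E E (A s)) (b := fun _ => 0) (c := 0)
    ((ContinuousLinearMap.compL ℝ E E E).continuous.comp_continuousOn hDc) continuousOn_const
    (fun s hs => (ContinuousLinearMap.opNorm_le_bound _ (norm_nonneg _) fun T =>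
      (A s).opNorm_comp_le T).trans (hA s hs)) (by simp) (ContinuousLinearMap.id ℝ E)
  refine ⟨Q 1, ?_⟩
  have hBγ : ∀ s ∈ Icc (0 : ℝ) 1, HasDerivWithinAt (fun s => B (γ s))
      (fderiv ℝ B (γ s) (B (γ s) ξ)) (Icc 0 1) s := fun s hs =>
    (hB.differentiable (by simp) (γ s)).hasFDerivAt.comp_hasDerivWithinAt s (hγ s hs)
  -- Both terms solve `X' = A X + X D(A)`: the first by `hJ`, the second because `D` reverses
  -- composition. They agree at `s = 0`.
  let W : ℝ → F →L[ℝ] E := fun s => B (γ s) - ((Q s).comp (B (γ 0))).comp (D (Q s))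
  have h := eq_zero_of_norm_deriv_le (w := W)
    (w' := fun s => (A s).comp (W s) + (W s).comp (D (A s))) (K := 1)
    (fun s hs => by
      have hQs : HasDerivWithinAt Q ((A s).comp (Q s)) (Icc 0 1) s :=
        (hQ s hs).congr_deriv (add_zero _)
      have hP : HasDerivWithinAt (fun s => D (Q s)) (D ((A s).comp (Q s))) (Icc 0 1) s :=
        D.hasFDerivAt.comp_hasDerivWithinAt s hQs
      have hd := (hBγ s hs).sub
        ((hQs.clm_comp (hasDerivWithinAt_const s (Icc (0 : ℝ) 1) (B (γ 0)))).clm_comp hP)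
      refine hd.congr_deriv ?_
      ext1 ζ
      have hJs : fderiv ℝ B (γ s) (B (γ s) ξ) ζ = A s (B (γ s) ζ) + B (γ s) (D (A s) ζ) :=
        hJ s hs ζ
      simp only [W, sub_apply, add_apply, ContinuousLinearMap.comp_apply, hJs, map_sub,
        hD_comp, ContinuousLinearMap.comp_zero, add_zero]
      abel)
    (fun s hs => by
      have h1 := (A s).opNorm_comp_le (W s)
      have h2 := (W s).opNorm_comp_le (D (A s))
      have h3 := (hD (A s)).trans (hA s hs)
      have h4 := hA s hs
      have h5 := norm_add_le ((A s).comp (W s)) ((W s).comp (D (A s)))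
      have h6 := mul_le_mul_of_nonneg_right h4 (norm_nonneg (W s))
      have h7 := mul_le_mul_of_nonneg_left h3 (norm_nonneg (W s))
      linarith)
    (by
      ext1 ζ
      simp [W, hQ0, hD_id])
  exact sub_eq_zero.1 h

end PoissonTransport

/-! ### Integral manifolds of a Poisson tensor in a vector space -/

section LocalIntegral

set_option synthInstance.maxHeartbeats 200000
set_option maxHeartbeats 400000

open Set Filter Topology unitInterval ContinuousMap

universe u

variable {E F : Type u} [NormedAddCommGroup E] [NormedSpace ℝ E] [FiniteDimensional ℝ E]
  [NormedAddCommGroup F] [NormedSpace ℝ F] [FiniteDimensional ℝ F]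

/-- The time-one map of the flows of `B ξ`, as a function of `ξ`: it is smooth near `0`, its
differential takes values in the range of `B`, and the rank of `B` does not increase along it. -/
theorem exists_timeOne_map {B : E → F →L[ℝ] E} {D : (E →L[ℝ] E) →L[ℝ] F →L[ℝ] F}
    (hB : ContDiff ℝ ∞ B) (hD : ∀ T, ‖D T‖ ≤ ‖T‖)
    (hD_id : D (ContinuousLinearMap.id ℝ E) = ContinuousLinearMap.id ℝ F)
    (hD_comp : ∀ S T : E →L[ℝ] E, D (S.comp T) = (D T).comp (D S))
    {x₀ : E} {U : Set E} (hU : U ∈ 𝓝 x₀)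
    (hJ : ∀ z ∈ U, ∀ ξ ζ, fderiv ℝ B z (B z ξ) ζ =
      fderiv ℝ B z (B z ζ) ξ + B z (D ((fderiv ℝ B z).flip ξ) ζ)) :
    ∃ φ : F → E, φ 0 = x₀ ∧ fderiv ℝ φ 0 = B x₀ ∧
      ∀ᶠ ξ in 𝓝 (0 : F), ContDiffAt ℝ ∞ φ ξ ∧ φ ξ ∈ U ∧
        LinearMap.range (fderiv ℝ φ ξ).toLinearMap ≤ LinearMap.range (B (φ ξ)).toLinearMap ∧
        Module.finrank ℝ (LinearMap.range (B (φ ξ)).toLinearMap) ≤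
          Module.finrank ℝ (LinearMap.range (B x₀).toLinearMap) := by
  have : CompleteSpace E := FiniteDimensional.complete ℝ E
  have : CompleteSpace F := FiniteDimensional.complete ℝ F
  obtain ⟨Γ, hΓ0, hΓ⟩ := exists_contDiffAt_solutions hB x₀
  let ev : C(I, E) →L[ℝ] E := ContinuousMap.evalCLM ℝ (1 : I)
  have hev : ∀ u : C(I, E), ev u = u 1 := fun u => rfl
  have hlin := fun ξ (hξ : ∀ᶠ ξ in 𝓝 ξ, ContDiffAt ℝ ∞ Γ ξ ∧
      Γ ξ = constCLM I E x₀ + pathPrimitive E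
        (clmApply I F E ((⟨B, hB.continuous⟩ : C(E, F →L[ℝ] E)).comp (Γ ξ)) (constCLM I F ξ))) η =>
    fderiv_solutions_eq_primitive hB
      ((hξ.self_of_nhds.1.differentiableAt (by simp)).hasFDerivAt) (hξ.mono fun _ h => h.2) η
  have hfd : ∀ ξ, ContDiffAt ℝ ∞ Γ ξ →
      fderiv ℝ (fun ξ => Γ ξ 1) ξ = ev.comp (fderiv ℝ Γ ξ) := fun ξ hξ =>
    (ev.hasFDerivAt.comp ξ (hξ.differentiableAt (by simp)).hasFDerivAt).fderiv
  refine ⟨fun ξ => Γ ξ 1, congrArg (fun u : C(I, E) => u 1) hΓ0, ?_, ?_⟩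
  · rw [hfd 0 hΓ.self_of_nhds.1]
    ext1 η
    obtain ⟨u, hu, hus⟩ := hlin 0 hΓ η
    -- At `ξ = 0` the curve is constant, and the linearized equation has the constant right-hand
    -- side `B x₀ η`.
    have hu' : u = constCLM I E (B x₀ η) := by
      ext s
      rw [hus, hΓ0]
      simp
    rw [ContinuousLinearMap.comp_apply, hev, hu, hu', map_zero, zero_add, pathPrimitive_constCLM]
  · have hDB : Continuous fun z => ‖fderiv ℝ B z‖ :=
      continuous_norm.comp (hB.continuous_fderiv (by simp))
    -- Keeping the curve where `fderiv ℝ B` is bounded by this constant, and `ξ` small against it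
    -- (`hsmall`), gives the bound `1 / 2` assumed by the transport lemmas.
    have hV : U ∩ {z | ‖fderiv ℝ B z‖ < ‖fderiv ℝ B x₀‖ + 1} ∈ 𝓝 x₀ :=
      inter_mem hU (hDB.continuousAt.eventually (gt_mem_nhds (lt_add_one _)))
    obtain ⟨δ, hδ, hball⟩ := Metric.mem_nhds_iff.1 hV
    have hnear : ∀ᶠ ξ in 𝓝 (0 : F), dist (Γ ξ) (Γ 0) < δ :=
      hΓ.self_of_nhds.1.continuousAt.eventually (Metric.ball_mem_nhds _ hδ)
    have hsmall : ∀ᶠ ξ in 𝓝 (0 : F), (‖fderiv ℝ B x₀‖ + 1) * ‖ξ‖ < 1 / 2 := by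
      have hc : Continuous fun ξ : F => (‖fderiv ℝ B x₀‖ + 1) * ‖ξ‖ := by fun_prop
      exact hc.continuousAt.eventually (gt_mem_nhds (by simp))
    filter_upwards [hΓ.eventually_nhds, hnear, hsmall] with ξ hξ hξδ hξs
    have hmem : ∀ s : I, Γ ξ s ∈ U ∩ {z | ‖fderiv ℝ B z‖ < ‖fderiv ℝ B x₀‖ + 1} := by
      intro s
      refine hball ?_
      have h1 := (ContinuousMap.dist_apply_le_dist (f := Γ ξ) (g := Γ 0) s).trans_lt hξδ
      rw [hΓ0] at h1
      exact h1
    let γ : ℝ → E := fun s => Γ ξ (projIcc 0 1 zero_le_one s)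
    have hγ1 : γ 1 = Γ ξ 1 := by
      change Γ ξ (projIcc 0 1 zero_le_one 1) = _
      rw [projIcc_right]
      rfl
    have hγ0 : γ 0 = x₀ := by
      change Γ ξ (projIcc 0 1 zero_le_one 0) = _
      rw [projIcc_left, hξ.self_of_nhds.2]
      change x₀ + pathPrimitive E _ 0 = x₀
      rw [pathPrimitive_zero, add_zero]
    have hγ : ∀ s ∈ Icc (0 : ℝ) 1, HasDerivWithinAt γ (B (γ s) ξ) (Icc 0 1) s := fun s hs =>
      hasDerivWithinAt_of_eq_primitive hξ.self_of_nhds.2 hs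
    have hA : ∀ s ∈ Icc (0 : ℝ) 1, ‖(fderiv ℝ B (γ s)).flip ξ‖ ≤ 1 / 2 := by
      intro s _
      refine (ContinuousLinearMap.le_opNorm _ ξ).trans ?_
      rw [ContinuousLinearMap.opNorm_flip]
      exact (mul_le_mul_of_nonneg_right (hmem _).2.le (norm_nonneg ξ)).trans hξs.le
    have hJ' : ∀ s ∈ Icc (0 : ℝ) 1, ∀ ζ, fderiv ℝ B (γ s) (B (γ s) ξ) ζ =
        fderiv ℝ B (γ s) (B (γ s) ζ) ξ + B (γ s) (D ((fderiv ℝ B (γ s)).flip ξ) ζ) :=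
      fun s _ ζ => hJ _ (hmem _).1 ξ ζ
    refine ⟨ev.contDiff.contDiffAt.comp ξ hξ.self_of_nhds.1, (hmem 1).1, ?_, ?_⟩
    · rintro _ ⟨η, rfl⟩
      obtain ⟨u, hu, hus⟩ := hlin ξ hξ η
      obtain ⟨α, hα⟩ := exists_eq_apply_of_linearized hB hD hγ hJ' hA
        (ψ := fun s => fderiv ℝ Γ ξ η (projIcc 0 1 zero_le_one s)) (η := η)
        (by
          rw [projIcc_left, hu]
          change 0 + pathPrimitive E u 0 = 0
          rw [pathPrimitive_zero, add_zero])
        (fun s hs => (hasDerivWithinAt_of_eq_primitive hu hs).congr_deriv (hus _))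
      refine ⟨α, ?_⟩
      rw [hfd ξ hξ.self_of_nhds.1]
      rw [hγ1, projIcc_right] at hα
      exact hα.symm
    · obtain ⟨Q, hQ⟩ := exists_conj_of_hamiltonian_flow hB hD hD_id hD_comp hγ hJ' hA
      rw [hγ1, hγ0] at hQ
      have hle : LinearMap.range (B (Γ ξ 1)).toLinearMap ≤
          (LinearMap.range (B x₀).toLinearMap).map Q.toLinearMap := by
        rintro _ ⟨ζ, rfl⟩
        rw [hQ]
        exact ⟨_, ⟨D Q ζ, rfl⟩, rfl⟩
      exact (Submodule.finrank_mono hle).trans (Submodule.finrank_map_le _ _)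

/-- Near a point, a map with injective differential is an injective immersion. -/
theorem eventually_injective_fderiv_and_injOn {G : Type*} [NormedAddCommGroup G] [NormedSpace ℝ G]
    [FiniteDimensional ℝ G] {φ : G → E} {w₀ : G} (hφ : ContDiffAt ℝ ∞ φ w₀)
    (hinj : Function.Injective (fderiv ℝ φ w₀)) :
    (∀ᶠ w in 𝓝 w₀, Function.Injective (fderiv ℝ φ w)) ∧ ∃ s ∈ 𝓝 w₀, InjOn φ s := by
  have : CompleteSpace G := FiniteDimensional.complete ℝ G
  -- Composition with a left inverse reduces both claims to a map `S ∘ φ` whose differential at `w₀`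
  -- is the identity: invertibility is open, and the inverse function theorem gives local
  -- injectivity.
  obtain ⟨S₀, hS₀⟩ := (fderiv ℝ φ w₀).toLinearMap.exists_leftInverse_of_injective
    (LinearMap.ker_eq_bot.2 hinj)
  let S : E →L[ℝ] G := LinearMap.toContinuousLinearMap S₀
  have hS : S.comp (fderiv ℝ φ w₀) = (ContinuousLinearEquiv.refl ℝ G : G →L[ℝ] G) := by
    ext w
    exact LinearMap.congr_fun hS₀ w
  constructor
  · have hc : ContinuousAt (fun w => S.comp (fderiv ℝ φ w)) w₀ :=
      continuousAt_const.clm_comp (hφ.continuousAt_fderiv (by simp))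
    have hev : ∀ᶠ w in 𝓝 w₀, S.comp (fderiv ℝ φ w) ∈
        range ((↑) : (G ≃L[ℝ] G) → G →L[ℝ] G) := by
      refine hc.eventually ?_
      change ∀ᶠ T in 𝓝 (S.comp (fderiv ℝ φ w₀)), _
      rw [hS]
      exact ContinuousLinearEquiv.nhds _
    filter_upwards [hev] with w ⟨e, he⟩ a b hab
    refine e.injective ?_
    have h1 : ∀ a, e a = S (fderiv ℝ φ w a) := fun a => DFunLike.congr_fun he a
    rw [h1, h1, hab]
  · have hst : HasStrictFDerivAt (fun w => S (φ w))
        ((ContinuousLinearEquiv.refl ℝ G : G ≃L[ℝ] G) : G →L[ℝ] G) w₀ := by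
      rw [← hS]
      exact S.hasStrictFDerivAt.comp w₀ (hφ.hasStrictFDerivAt (by simp))
    let Φ := hst.toOpenPartialHomeomorph (fun w => S (φ w))
    refine ⟨Φ.source, Φ.open_source.mem_nhds hst.mem_toOpenPartialHomeomorph_source, ?_⟩
    intro a ha b hb hab
    exact Φ.injOn ha hb (congrArg S hab)

/-- Through every point near which `B` satisfies the Jacobi identity passes an integral manifold of
the range of `B`. -/
theorem exists_integral_immersion {B : E → F →L[ℝ] E} {D : (E →L[ℝ] E) →L[ℝ] F →L[ℝ] F}
    (hB : ContDiff ℝ ∞ B) (hD : ∀ T, ‖D T‖ ≤ ‖T‖)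
    (hD_id : D (ContinuousLinearMap.id ℝ E) = ContinuousLinearMap.id ℝ F)
    (hD_comp : ∀ S T : E →L[ℝ] E, D (S.comp T) = (D T).comp (D S))
    {x₀ : E} {U : Set E} (hU : U ∈ 𝓝 x₀)
    (hJ : ∀ z ∈ U, ∀ ξ ζ, fderiv ℝ B z (B z ξ) ζ =
      fderiv ℝ B z (B z ζ) ξ + B z (D ((fderiv ℝ B z).flip ξ) ζ)) :
    ∃ (k : ℕ) (φ : EuclideanSpace ℝ (Fin k) → E), ContDiff ℝ ∞ φ ∧ Function.Injective φ ∧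
      φ 0 = x₀ ∧ ∀ w, φ w ∈ U ∧ Function.Injective (fderiv ℝ φ w) ∧
        LinearMap.range (fderiv ℝ φ w).toLinearMap = LinearMap.range (B (φ w)).toLinearMap := by
  obtain ⟨φ, hφ0, hφ', hφ⟩ := exists_timeOne_map hB hD hD_id hD_comp hU hJ
  let R := LinearMap.range (B x₀).toLinearMap
  -- The image of `r` is a complement of `ker (B x₀)`. Parametrizing it by `l`, the differential of
  -- `φ ∘ l` at `0` becomes the injective map `e`.
  obtain ⟨r, hr⟩ := (B x₀).toLinearMap.rangeRestrict.exists_rightInverse_of_surjective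
    (LinearMap.range_rangeRestrict _)
  let k := Module.finrank ℝ R
  let e : EuclideanSpace ℝ (Fin k) ≃ₗ[ℝ] R := LinearEquiv.ofFinrankEq _ _ (by simp [k])
  let l : EuclideanSpace ℝ (Fin k) →L[ℝ] F := LinearMap.toContinuousLinearMap (r ∘ₗ e.toLinearMap)
  have hl : ∀ w, B x₀ (l w) = e w := fun w =>
    congrArg Subtype.val (LinearMap.congr_fun hr (e w))
  have hl0 : Tendsto l (𝓝 0) (𝓝 0) := by
    have := l.continuous.tendsto 0
    rwa [map_zero] at this
  have hfd : ∀ w, ContDiffAt ℝ ∞ φ (l w) →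
      fderiv ℝ (fun w => φ (l w)) w = (fderiv ℝ φ (l w)).comp l := fun w hw =>
    ((hw.differentiableAt (by simp)).hasFDerivAt.comp w l.hasFDerivAt).fderiv
  have hev := hl0.eventually hφ
  have hc0 : ContDiffAt ℝ ∞ (fun w => φ (l w)) 0 := by
    refine ContDiffAt.comp (g := φ) 0 ?_ l.contDiff.contDiffAt
    rw [map_zero]
    exact hφ.self_of_nhds.1
  have hinj0 : Function.Injective (fderiv ℝ (fun w => φ (l w)) 0) := by
    rw [hfd 0 (hev.self_of_nhds.1), map_zero, hφ']
    intro a b hab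
    simp only [ContinuousLinearMap.comp_apply, hl] at hab
    exact e.injective (Subtype.ext hab)
  obtain ⟨hinj, s, hs, hsinj⟩ := eventually_injective_fderiv_and_injOn hc0 hinj0
  obtain ⟨ρ, hρ, hball⟩ := Metric.mem_nhds_iff.1 (inter_mem (hev.and hinj) hs)
  -- A diffeomorphism of the whole space onto the good ball, fixing `0`, makes the parametrization
  -- global.
  let b := OpenPartialHomeomorph.univBall (0 : EuclideanSpace ℝ (Fin k)) ρ
  have hb_mem : ∀ w, b w ∈ Metric.ball (0 : EuclideanSpace ℝ (Fin k)) ρ := fun w => by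
    have h := b.map_source (x := w) (by simp [b])
    rwa [OpenPartialHomeomorph.univBall_target _ hρ] at h
  have hb : ContDiff ℝ ∞ b := OpenPartialHomeomorph.contDiff_univBall
  have hb_symm : ContDiffOn ℝ ∞ b.symm (Metric.ball 0 ρ) :=
    OpenPartialHomeomorph.contDiffOn_univBall_symm
  have hb_bij : ∀ w, Function.Bijective (fderiv ℝ b w) := by
    intro w
    have hd1 : HasFDerivAt b (fderiv ℝ b w) w := (hb.differentiable (by simp) w).hasFDerivAt
    have hd2 : HasFDerivAt b.symm (fderiv ℝ b.symm (b w)) (b w) :=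
      ((hb_symm.contDiffAt (Metric.isOpen_ball.mem_nhds (hb_mem w))).differentiableAt
        (by simp)).hasFDerivAt
    have hcomp : (fderiv ℝ b.symm (b w)).comp (fderiv ℝ b w) = ContinuousLinearMap.id ℝ _ := by
      refine (hd2.comp w hd1).unique ((hasFDerivAt_id w).congr_of_eventuallyEq ?_)
      exact .of_forall fun v => b.left_inv (by simp [b])
    have hi : Function.Injective (fderiv ℝ b w) := fun x y hxy => by
      have h := congrArg (fderiv ℝ b.symm (b w)) hxy
      have h1 : ∀ x, fderiv ℝ b.symm (b w) (fderiv ℝ b w x) = x :=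
        fun x => DFunLike.congr_fun hcomp x
      rwa [h1, h1] at h
    exact ⟨hi, (LinearMap.injective_iff_surjective (f := (fderiv ℝ b w).toLinearMap)).1 hi⟩
  have hcd : ∀ w, ContDiffAt ℝ ∞ (fun w => φ (l w)) (b w) := fun w =>
    ContDiffAt.comp (g := φ) _ (hball (hb_mem w)).1.1.1 l.contDiff.contDiffAt
  have hfd2 : ∀ w, fderiv ℝ (fun w => φ (l (b w))) w =
      (fderiv ℝ (fun w => φ (l w)) (b w)).comp (fderiv ℝ b w) := fun w =>
    (((hcd w).differentiableAt (by simp)).hasFDerivAt.comp w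
      (hb.differentiable (by simp) w).hasFDerivAt).fderiv
  refine ⟨k, fun w => φ (l (b w)), ?_, ?_, ?_, fun w => ⟨(hball (hb_mem w)).1.1.2.1, ?_, ?_⟩⟩
  · exact contDiff_iff_contDiffAt.2 fun w => (hcd w).comp w hb.contDiffAt
  · intro v w hvw
    have h := hsinj (hball (hb_mem v)).2 (hball (hb_mem w)).2 hvw
    exact b.injOn (by simp [b]) (by simp [b]) h
  · simp [b, hφ0]
  · rw [hfd2]
    exact ((hball (hb_mem w)).1.2).comp (hb_bij w).1
  · rw [hfd2]
    have h1 : LinearMap.range ((fderiv ℝ (fun w => φ (l w)) (b w)).comp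
        (fderiv ℝ b w)).toLinearMap =
        LinearMap.range (fderiv ℝ (fun w => φ (l w)) (b w)).toLinearMap :=
      LinearMap.range_comp_of_range_eq_top _ (LinearMap.range_eq_top.2 (hb_bij w).2)
    rw [h1]
    obtain ⟨⟨⟨hcw, -, hrw, hkw⟩, hiw⟩, -⟩ := hball (hb_mem w)
    -- The differential has rank `k` by injectivity, while `B (φ w)` has rank at most that of `B
    -- x₀`, which is `k`.
    refine Submodule.eq_of_le_of_finrank_le ?_ ?_
    · rw [hfd _ hcw]
      refine le_trans ?_ hrw
      rintro _ ⟨v, rfl⟩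
      exact ⟨l v, rfl⟩
    · refine hkw.trans ?_
      rw [LinearMap.finrank_range_of_inj hiw]
      simp [k, R]

end LocalIntegral

theorem ContDiffOn.smul_const_vector {E G : Type*} [NormedAddCommGroup E] [NormedSpace ℝ E]
    [NormedAddCommGroup G] [NormedSpace ℝ G] {n : ℕ∞ω} {f : E → ℝ} {s : Set E}
    (hf : ContDiffOn ℝ n f s) (c : G) : ContDiffOn ℝ n (fun z => f z • c) s :=
  hf.fun_smul contDiffOn_const

/-! ### Cut-off coordinate functions -/

section CoordinateFunctions

open Set Filter Topology

variable {E : Type*} [NormedAddCommGroup E] [NormedSpace ℝ E] [FiniteDimensional ℝ E]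
  {M : Type*} [TopologicalSpace M] [ChartedSpace E M] [IsManifold 𝓘(ℝ, E) ∞ M] [T2Space M]
  {x₀ : M} (χ : SmoothBumpFunction 𝓘(ℝ, E) x₀)

/-- A linear form in the chart at `x₀`, cut off to a global smooth function. -/
noncomputable def coordFun (ξ : E →L[ℝ] ℝ) : C^∞⟮𝓘(ℝ, E), M; ℝ⟯ :=
  ⟨fun x => χ x • ξ (extChartAt 𝓘(ℝ, E) x₀ x),
    χ.contMDiff_smul (ξ.contMDiff.comp_contMDiffOn contMDiffOn_extChartAt)⟩

/-- The points of the chart domain near which the bump function is constant. -/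
def coordDomain : Set M := {x | x ∈ (extChartAt 𝓘(ℝ, E) x₀).source ∧ χ =ᶠ[𝓝 x] 1}

theorem coordDomain_mem_nhds : coordDomain χ ∈ 𝓝 x₀ :=
  inter_mem (extChartAt_source_mem_nhds (I := 𝓘(ℝ, E)) x₀) χ.eventuallyEq_one.eventually_nhds

theorem coordFun_eventuallyEq {x : M} (hx : x ∈ coordDomain χ) (ξ : E →L[ℝ] ℝ) :
    coordFun χ ξ =ᶠ[𝓝 x] fun y => ξ (extChartAt 𝓘(ℝ, E) x₀ y) := by
  filter_upwards [hx.2] with y hy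
  change χ y • ξ _ = _
  rw [hy, Pi.one_apply, one_smul]

theorem mvfderiv_coordFun {x : M} (hx : x ∈ coordDomain χ) (ξ : E →L[ℝ] ℝ)
    (v : TangentSpace 𝓘(ℝ, E) x) :
    mvfderiv 𝓘(ℝ, E) (coordFun χ ξ) x v =
      ξ (mvfderiv 𝓘(ℝ, E) (extChartAt 𝓘(ℝ, E) x₀) x v) := by
  have h1 : mvfderiv 𝓘(ℝ, E) (coordFun χ ξ) x =
      mvfderiv 𝓘(ℝ, E) (fun y => ξ (extChartAt 𝓘(ℝ, E) x₀ y)) x :=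
    (coordFun_eventuallyEq χ hx ξ).mfderiv_eq
  have hd : MDifferentiableAt 𝓘(ℝ, E) 𝓘(ℝ, E) (extChartAt 𝓘(ℝ, E) x₀) x :=
    mdifferentiableAt_extChartAt (by simpa using hx.1)
  have h2 := mfderiv_comp (I := 𝓘(ℝ, E)) (I' := 𝓘(ℝ, E)) (I'' := 𝓘(ℝ, ℝ)) x
    (ξ.mdifferentiableAt (x := extChartAt 𝓘(ℝ, E) x₀ x)) hd
  rw [ξ.mfderiv_eq] at h2
  rw [h1]
  exact DFunLike.congr_fun h2 v

theorem mvfderiv_extChartAt_injective {x : M} (hx : x ∈ (extChartAt 𝓘(ℝ, E) x₀).source) :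
    Function.Injective (mvfderiv 𝓘(ℝ, E) (extChartAt 𝓘(ℝ, E) x₀) x) :=
  (isInvertible_mfderiv_extChartAt hx).injective

theorem exists_mvfderiv_coordFun_eq {x : M} (hx : x ∈ coordDomain χ)
    (θ : TangentSpace 𝓘(ℝ, E) x →ₗ[ℝ] ℝ) :
    ∃ ξ : E →L[ℝ] ℝ, ∀ v, mvfderiv 𝓘(ℝ, E) (coordFun χ ξ) x v = θ v := by
  obtain ⟨g, hg⟩ := (mvfderiv 𝓘(ℝ, E) (extChartAt 𝓘(ℝ, E) x₀) x).toLinearMap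
    |>.exists_leftInverse_of_injective (LinearMap.ker_eq_bot.2 (mvfderiv_extChartAt_injective hx.1))
  refine ⟨LinearMap.toContinuousLinearMap (θ ∘ₗ g), fun v => ?_⟩
  rw [mvfderiv_coordFun χ hx]
  exact congrArg θ (LinearMap.congr_fun hg v)

end CoordinateFunctions

/-! ### The distribution spanned by Hamiltonian fields -/

namespace CompatibleTriple

variable {E : Type*} [NormedAddCommGroup E] [NormedSpace ℝ E] [FiniteDimensional ℝ E]
  {M : Type*} [TopologicalSpace M] [ChartedSpace E M] [IsManifold 𝓘(ℝ, E) ∞ M] [T2Space M]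
  {V : Type*} [NormedAddCommGroup V] [NormedSpace ℝ V] [FiniteDimensional ℝ V]
  {A : M → Type*} [TopologicalSpace (TotalSpace V A)]
  [∀ x, AddCommGroup (A x)] [∀ x, Module ℝ (A x)] [∀ x, TopologicalSpace (A x)]
  [∀ x, IsTopologicalAddGroup (A x)] [∀ x, ContinuousConstSMul ℝ (A x)]
  [FiberBundle V A] [VectorBundle ℝ V A]
  {𝓐 : LieAlgebroid E V A} (τ : CompatibleTriple 𝓐)

/-- For `a ∈ L^Ω`, `Ω(a, ·)` factors through `ρ` as a covector `θ`. A cut-off linear form with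
differential `θ` at `x` has Hamiltonian value `a` there, by nondegeneracy. -/
theorem mem_Λ_iff_coordFun {x₀ : M} (χ : SmoothBumpFunction 𝓘(ℝ, E) x₀) {x : M}
    (hx : x ∈ coordDomain χ) {v : TangentSpace 𝓘(ℝ, E) x} :
    v ∈ τ.Λ x ↔ ∃ ξ, 𝓐.anchor x (τ.Ω.hamiltonian (coordFun χ ξ) x) = v := by
  rw [τ.mem_Λ]
  constructor
  · rintro ⟨a, ha, rfl⟩
    obtain ⟨θ, hθ⟩ := τ.Ω.exists_of_mem_orth_L ha
    obtain ⟨ξ, hξ⟩ := exists_mvfderiv_coordFun_eq χ hx θ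
    refine ⟨ξ, ?_⟩
    rw [τ.Ω.eq_hamiltonian (a := a) (f := coordFun χ ξ) fun b => ?_]
    rw [hθ, ← hξ]
    rfl
  · rintro ⟨ξ, rfl⟩
    exact ⟨_, τ.Ω.hamiltonian_mem_orth_L _ x, rfl⟩

theorem isSmoothDistribution_Λ [ContMDiffVectorBundle ∞ V A 𝓘(ℝ, E)] :
    IsSmoothDistribution τ.Λ := by
  intro x v hv
  let χ : SmoothBumpFunction 𝓘(ℝ, E) x := Classical.arbitrary _
  obtain ⟨ξ, rfl⟩ := (τ.mem_Λ_iff_coordFun χ (mem_of_mem_nhds (coordDomain_mem_nhds χ))).1 hv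
  refine ⟨⟨fun y => 𝓐.anchor y (τ.Ω.hamiltonian (coordFun χ ξ) y), fun y =>
    𝓐.contMDiffAt_anchor_apply (τ.Ω.contMDiff_hamiltonian _ y)⟩, rfl, fun y => ?_⟩
  exact τ.mem_Λ.2 ⟨_, τ.Ω.hamiltonian_mem_orth_L _ y, rfl⟩

end CompatibleTriple

/-! ### The Poisson tensor in a chart -/

namespace SymplecticForm

open Set Filter Topology

variable {E : Type*} [NormedAddCommGroup E] [NormedSpace ℝ E] [FiniteDimensional ℝ E]
  {M : Type*} [TopologicalSpace M] [ChartedSpace E M] [IsManifold 𝓘(ℝ, E) ∞ M] [T2Space M]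
  {V : Type*} [NormedAddCommGroup V] [NormedSpace ℝ V] [FiniteDimensional ℝ V]
  {A : M → Type*} [TopologicalSpace (TotalSpace V A)]
  [∀ x, AddCommGroup (A x)] [∀ x, Module ℝ (A x)] [∀ x, TopologicalSpace (A x)]
  [∀ x, IsTopologicalAddGroup (A x)] [∀ x, ContinuousConstSMul ℝ (A x)]
  [FiberBundle V A] [VectorBundle ℝ V A]
  {𝓐 : LieAlgebroid E V A} (Ω : SymplecticForm 𝓐)
  {x₀ : M} (χ : SmoothBumpFunction 𝓘(ℝ, E) x₀)

/-- The Poisson tensor in the chart at `x₀`. -/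
noncomputable def chartTensor (z : E) : (E →L[ℝ] ℝ) →L[ℝ] E :=
  ∑ i, ∑ j, Ω.poissonBracket
      (coordFun χ (LinearMap.toContinuousLinearMap ((Module.finBasis ℝ E).coord j)))
      (coordFun χ (LinearMap.toContinuousLinearMap ((Module.finBasis ℝ E).coord i)))
      ((extChartAt 𝓘(ℝ, E) x₀).symm z) •
    (ContinuousLinearMap.apply ℝ ℝ (Module.finBasis ℝ E i)).smulRight (Module.finBasis ℝ E j)

theorem contDiffOn_chartTensor [ContMDiffVectorBundle ∞ V A 𝓘(ℝ, E)] :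
    ContDiffOn ℝ ∞ (Ω.chartTensor χ) (extChartAt 𝓘(ℝ, E) x₀).target := by
  refine ContDiffOn.sum fun i _ => ContDiffOn.sum fun j _ => ?_
  have h := ((Ω.contMDiff_poissonBracket
    (coordFun χ (LinearMap.toContinuousLinearMap ((Module.finBasis ℝ E).coord j)))
    (coordFun χ (LinearMap.toContinuousLinearMap ((Module.finBasis ℝ E).coord i)))).comp_contMDiffOn
    (contMDiffOn_extChartAt_symm x₀)).contDiffOn
  exact h.smul_const_vector _

/-- The bracket at `x` depends only on the differentials at `x`, so both sides are bilinear in `ξ`,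
`η` and it suffices to expand in the dual basis. -/
theorem apply_chartTensor {x : M} (hx : x ∈ coordDomain χ) (ξ η : E →L[ℝ] ℝ) :
    η (Ω.chartTensor χ (extChartAt 𝓘(ℝ, E) x₀ x) ξ) =
      Ω.poissonBracket (coordFun χ η) (coordFun χ ξ) x := by
  let b := Module.finBasis ℝ E
  have hlin : ∀ η f, Ω.poissonBracket (coordFun χ η) f x = ∑ j, η (b j) *
      Ω.poissonBracket (coordFun χ (LinearMap.toContinuousLinearMap (b.coord j))) f x := by
    intro η f
    simp only [poissonBracket_apply, mvfderiv_coordFun χ hx]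
    generalize mvfderiv 𝓘(ℝ, E) (extChartAt 𝓘(ℝ, E) x₀) x (𝓐.anchor x (Ω.hamiltonian f x)) = w
    have hw : (w : E) = ∑ j, b.repr w j • b j := (b.sum_repr w).symm
    refine (congrArg η hw).trans ?_
    rw [map_sum]
    refine Finset.sum_congr rfl fun j _ => ?_
    rw [map_smul, smul_eq_mul, mul_comm]
    rfl
  have hlin' : ∀ f ξ, Ω.poissonBracket f (coordFun χ ξ) x = ∑ i, ξ (b i) *
      Ω.poissonBracket f (coordFun χ (LinearMap.toContinuousLinearMap (b.coord i))) x := by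
    intro f ξ
    rw [poissonBracket_skew, hlin, ← Finset.sum_neg_distrib]
    refine Finset.sum_congr rfl fun i _ => ?_
    rw [poissonBracket_skew _ _ f]
    ring
  rw [hlin']
  simp only [hlin η]
  simp only [chartTensor, (extChartAt 𝓘(ℝ, E) x₀).left_inv hx.1, sum_apply, map_sum, smul_apply,
    ContinuousLinearMap.smulRight_apply, ContinuousLinearMap.apply_apply, map_smul, smul_eq_mul,
    Finset.mul_sum]
  refine Finset.sum_congr rfl fun i _ => Finset.sum_congr rfl fun j _ => ?_
  ring

/-- This identifies the range of the tensor with the chart image of `Λ`. -/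
theorem mvfderiv_extChartAt_hamiltonian {x : M} (hx : x ∈ coordDomain χ) (ξ : E →L[ℝ] ℝ) :
    mvfderiv 𝓘(ℝ, E) (extChartAt 𝓘(ℝ, E) x₀) x
      (𝓐.anchor x (Ω.hamiltonian (coordFun χ ξ) x)) =
      Ω.chartTensor χ (extChartAt 𝓘(ℝ, E) x₀ x) ξ := by
  refine (SeparatingDual.eq_iff_forall_dual_eq (R := ℝ)).2 fun η => ?_
  rw [apply_chartTensor Ω χ hx, poissonBracket_apply, mvfderiv_coordFun χ hx]

/-- Brackets with coordinate functions, computed in the chart. -/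
theorem poissonBracket_coordFun {x : M} (hx : x ∈ coordDomain χ) (h : C^∞⟮𝓘(ℝ, E), M; ℝ⟯)
    (ξ : E →L[ℝ] ℝ) :
    Ω.poissonBracket h (coordFun χ ξ) x =
      fderiv ℝ (fun z => h ((extChartAt 𝓘(ℝ, E) x₀).symm z)) (extChartAt 𝓘(ℝ, E) x₀ x)
        (Ω.chartTensor χ (extChartAt 𝓘(ℝ, E) x₀ x) ξ) := by
  rw [← Ω.mvfderiv_extChartAt_hamiltonian χ hx, poissonBracket_apply]
  set v := 𝓐.anchor x (Ω.hamiltonian (coordFun χ ξ) x)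
  have hz : extChartAt 𝓘(ℝ, E) x₀ x ∈ (extChartAt 𝓘(ℝ, E) x₀).target :=
    (extChartAt 𝓘(ℝ, E) x₀).map_source hx.1
  have hd : MDifferentiableAt 𝓘(ℝ, E) 𝓘(ℝ, E) (extChartAt 𝓘(ℝ, E) x₀) x :=
    mdifferentiableAt_extChartAt (by simpa using hx.1)
  have hg : ContMDiffOn 𝓘(ℝ, E) 𝓘(ℝ, ℝ) ∞ (fun z => h ((extChartAt 𝓘(ℝ, E) x₀).symm z))
      (extChartAt 𝓘(ℝ, E) x₀).target :=
    h.contMDiff.comp_contMDiffOn (contMDiffOn_extChartAt_symm x₀)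
  have hg' : MDifferentiableAt 𝓘(ℝ, E) 𝓘(ℝ, ℝ) (fun z => h ((extChartAt 𝓘(ℝ, E) x₀).symm z))
      (extChartAt 𝓘(ℝ, E) x₀ x) :=
    (hg.contMDiffAt ((isOpen_extChartAt_target x₀).mem_nhds hz)).mdifferentiableAt (by simp)
  have hcomp := mfderiv_comp x hg' hd
  have heq : mfderiv 𝓘(ℝ, E) 𝓘(ℝ, ℝ) ((fun z => h ((extChartAt 𝓘(ℝ, E) x₀).symm z)) ∘
      extChartAt 𝓘(ℝ, E) x₀) x = mfderiv 𝓘(ℝ, E) 𝓘(ℝ, ℝ) h x := by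
    refine Filter.EventuallyEq.mfderiv_eq ?_
    filter_upwards [(isOpen_extChartAt_source (I := 𝓘(ℝ, E)) x₀).mem_nhds hx.1] with y hy
    exact congrArg h ((extChartAt 𝓘(ℝ, E) x₀).left_inv hy)
  rw [heq, mfderiv_eq_fderiv] at hcomp
  exact DFunLike.congr_fun hcomp v

end SymplecticForm

universe u

namespace SymplecticForm

variable {E : Type*} [NormedAddCommGroup E] [NormedSpace ℝ E]
  {M : Type*} [TopologicalSpace M] [ChartedSpace E M] [IsManifold 𝓘(ℝ, E) ∞ M]
  {V : Type*} [NormedAddCommGroup V] [NormedSpace ℝ V] [FiniteDimensional ℝ V]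
  {A : M → Type*} [TopologicalSpace (TotalSpace V A)]
  [∀ x, AddCommGroup (A x)] [∀ x, Module ℝ (A x)] [∀ x, TopologicalSpace (A x)]
  [∀ x, IsTopologicalAddGroup (A x)] [∀ x, ContinuousConstSMul ℝ (A x)]
  [FiberBundle V A] [VectorBundle ℝ V A] [ContMDiffVectorBundle ∞ V A 𝓘(ℝ, E)]
  {𝓐 : LieAlgebroid E V A} (Ω : SymplecticForm 𝓐)

/-- The Poisson bracket of two functions, as a smooth function. -/
noncomputable def bracketFun (f h : C^∞⟮𝓘(ℝ, E), M; ℝ⟯) : C^∞⟮𝓘(ℝ, E), M; ℝ⟯ :=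
  ⟨Ω.poissonBracket f h, Ω.contMDiff_poissonBracket f h⟩

theorem bracketFun_jacobi (f h k : C^∞⟮𝓘(ℝ, E), M; ℝ⟯) (x : M) :
    Ω.poissonBracket (Ω.bracketFun f h) k x + Ω.poissonBracket (Ω.bracketFun h k) f x +
      Ω.poissonBracket (Ω.bracketFun k f) h x = 0 := by
  have hj : Ω.poissonBracket f (Ω.bracketFun h k) x + Ω.poissonBracket h (Ω.bracketFun k f) x +
      Ω.poissonBracket k (Ω.bracketFun f h) x = 0 :=
    congrFun (Ω.isPoissonBracket.jacobi f h k) x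
  rw [Ω.poissonBracket_skew f, Ω.poissonBracket_skew h, Ω.poissonBracket_skew k] at hj
  linarith

end SymplecticForm

section Preliminaries

open Set Filter Topology

/-- A function smooth on an open set agrees near each of its points with a globally smooth one. -/
theorem exists_contDiff_eventuallyEq {E G : Type*} [NormedAddCommGroup E] [NormedSpace ℝ E]
    [FiniteDimensional ℝ E] [NormedAddCommGroup G] [NormedSpace ℝ G] {B₀ : E → G} {T : Set E}
    (hT : IsOpen T) {z₀ : E} (hz₀ : z₀ ∈ T) (hB₀ : ContDiffOn ℝ ∞ B₀ T) :
    ∃ B : E → G, ContDiff ℝ ∞ B ∧ B =ᶠ[𝓝 z₀] B₀ := by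
  obtain ⟨r, hr, hrT⟩ := Metric.nhds_basis_closedBall.mem_iff.1 (hT.mem_nhds hz₀)
  let f : ContDiffBump z₀ := ⟨r / 2, r, half_pos hr, half_lt_self hr⟩
  refine ⟨fun z => f z • B₀ z, contDiff_iff_contDiffAt.2 fun z => ?_, ?_⟩
  · by_cases hz : z ∈ T
    · exact f.contDiff.contDiffAt.fun_smul (hB₀.contDiffAt (hT.mem_nhds hz))
    · have hz' : z ∉ tsupport f := by
        rw [f.tsupport_eq]
        exact fun h => hz (hrT h)
      refine (contDiffAt_const (c := (0 : G))).congr_of_eventuallyEq ?_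
      filter_upwards [notMem_tsupport_iff_eventuallyEq.1 hz'] with y hy
      simp [hy]
  · filter_upwards [f.eventuallyEq_one] with z hz
    simp [hz]

/-- Transposition, as a map from endomorphisms of `E` to endomorphisms of its dual. -/
noncomputable def dualTranspose (E : Type*) [NormedAddCommGroup E] [NormedSpace ℝ E] :
    (E →L[ℝ] E) →L[ℝ] (E →L[ℝ] ℝ) →L[ℝ] E →L[ℝ] ℝ :=
  (ContinuousLinearMap.compL ℝ E E ℝ).flip

theorem dualTranspose_apply {E : Type*} [NormedAddCommGroup E] [NormedSpace ℝ E]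
    (T : E →L[ℝ] E) (ζ : E →L[ℝ] ℝ) : dualTranspose E T ζ = ζ.comp T := rfl

theorem norm_dualTranspose_le {E : Type*} [NormedAddCommGroup E] [NormedSpace ℝ E]
    (T : E →L[ℝ] E) : ‖dualTranspose E T‖ ≤ ‖T‖ :=
  ContinuousLinearMap.opNorm_le_bound _ (norm_nonneg _) fun ζ => by
    rw [dualTranspose_apply, mul_comm]
    exact ζ.opNorm_comp_le T

end Preliminaries

section

open Set Filter Topology

variable {E : Type*} [NormedAddCommGroup E] [NormedSpace ℝ E] [FiniteDimensional ℝ E]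
  {M : Type*} [TopologicalSpace M] [ChartedSpace E M] [IsManifold 𝓘(ℝ, E) ∞ M] [T2Space M]
  {x₀ : M} (χ : SmoothBumpFunction 𝓘(ℝ, E) x₀)

theorem isOpen_coordDomain : IsOpen (coordDomain χ) :=
  (isOpen_extChartAt_source (I := 𝓘(ℝ, E)) x₀).inter isOpen_setOfPred_eventually_nhds

theorem eventually_symm_mem_coordDomain {x : M} (hx : x ∈ coordDomain χ) :
    ∀ᶠ z in 𝓝 (extChartAt 𝓘(ℝ, E) x₀ x), z ∈ (extChartAt 𝓘(ℝ, E) x₀).target ∧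
      (extChartAt 𝓘(ℝ, E) x₀).symm z ∈ coordDomain χ := by
  have hz := (extChartAt 𝓘(ℝ, E) x₀).map_source hx.1
  refine Filter.Eventually.and ((isOpen_extChartAt_target x₀).mem_nhds hz) ?_
  refine (continuousAt_extChartAt_symm'' hz).eventually ?_
  rw [(extChartAt 𝓘(ℝ, E) x₀).left_inv hx.1]
  exact (isOpen_coordDomain χ).mem_nhds hx

end

/-! ### Jacobi identity of the chart tensor -/

namespace SymplecticForm

open Set Filter Topology

variable {E : Type*} [NormedAddCommGroup E] [NormedSpace ℝ E] [FiniteDimensional ℝ E]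
  {M : Type*} [TopologicalSpace M] [ChartedSpace E M] [IsManifold 𝓘(ℝ, E) ∞ M] [T2Space M]
  {V : Type*} [NormedAddCommGroup V] [NormedSpace ℝ V] [FiniteDimensional ℝ V]
  {A : M → Type*} [TopologicalSpace (TotalSpace V A)]
  [∀ x, AddCommGroup (A x)] [∀ x, Module ℝ (A x)] [∀ x, TopologicalSpace (A x)]
  [∀ x, IsTopologicalAddGroup (A x)] [∀ x, ContinuousConstSMul ℝ (A x)]
  [FiberBundle V A] [VectorBundle ℝ V A] [ContMDiffVectorBundle ∞ V A 𝓘(ℝ, E)]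
  {𝓐 : LieAlgebroid E V A} (Ω : SymplecticForm 𝓐)
  {x₀ : M} (χ : SmoothBumpFunction 𝓘(ℝ, E) x₀)

theorem apply_chartTensor_skew {x : M} (hx : x ∈ coordDomain χ) (ξ η : E →L[ℝ] ℝ) :
    η (Ω.chartTensor χ (extChartAt 𝓘(ℝ, E) x₀ x) ξ) =
      -ξ (Ω.chartTensor χ (extChartAt 𝓘(ℝ, E) x₀ x) η) := by
  rw [apply_chartTensor Ω χ hx, apply_chartTensor Ω χ hx, poissonBracket_skew]

theorem differentiableAt_chartTensor {x : M} (hx : x ∈ coordDomain χ) :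
    DifferentiableAt ℝ (Ω.chartTensor χ) (extChartAt 𝓘(ℝ, E) x₀ x) :=
  ((Ω.contDiffOn_chartTensor χ).contDiffAt ((isOpen_extChartAt_target x₀).mem_nhds
    ((extChartAt 𝓘(ℝ, E) x₀).map_source hx.1))).differentiableAt (by simp)

theorem fderiv_apply_chartTensor {x : M} (hx : x ∈ coordDomain χ) (ξ η : E →L[ℝ] ℝ) (v : E) :
    fderiv ℝ (fun z => η (Ω.chartTensor χ z ξ)) (extChartAt 𝓘(ℝ, E) x₀ x) v =
      η (fderiv ℝ (Ω.chartTensor χ) (extChartAt 𝓘(ℝ, E) x₀ x) v ξ) := by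
  have h := (Ω.differentiableAt_chartTensor χ hx).hasFDerivAt.clm_apply
    (hasFDerivAt_const ξ (extChartAt 𝓘(ℝ, E) x₀ x))
  have h' : HasFDerivAt (fun z => η (Ω.chartTensor χ z ξ)) _ (extChartAt 𝓘(ℝ, E) x₀ x) :=
    η.hasFDerivAt.comp _ h
  rw [h'.fderiv]
  simp

/-- Skewness of the tensor holds on a whole neighbourhood, hence can be differentiated. -/
theorem fderiv_chartTensor_skew {x : M} (hx : x ∈ coordDomain χ) (ξ η : E →L[ℝ] ℝ) (v : E) :
    η (fderiv ℝ (Ω.chartTensor χ) (extChartAt 𝓘(ℝ, E) x₀ x) v ξ) =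
      -ξ (fderiv ℝ (Ω.chartTensor χ) (extChartAt 𝓘(ℝ, E) x₀ x) v η) := by
  rw [← Ω.fderiv_apply_chartTensor χ hx, ← Ω.fderiv_apply_chartTensor χ hx]
  have h : (fun z => η (Ω.chartTensor χ z ξ)) =ᶠ[𝓝 (extChartAt 𝓘(ℝ, E) x₀ x)]
      fun z => -ξ (Ω.chartTensor χ z η) := by
    filter_upwards [eventually_symm_mem_coordDomain χ hx] with z hz
    have := Ω.apply_chartTensor_skew χ hz.2 ξ η
    rwa [(extChartAt 𝓘(ℝ, E) x₀).right_inv hz.1] at this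
  rw [h.fderiv_eq, fderiv_fun_neg]
  rfl

theorem poissonBracket_bracket_coordFun {x : M} (hx : x ∈ coordDomain χ) (θ ζ ξ : E →L[ℝ] ℝ) :
    Ω.poissonBracket (Ω.bracketFun (coordFun χ θ) (coordFun χ ζ)) (coordFun χ ξ) x =
      θ (fderiv ℝ (Ω.chartTensor χ) (extChartAt 𝓘(ℝ, E) x₀ x)
        (Ω.chartTensor χ (extChartAt 𝓘(ℝ, E) x₀ x) ξ) ζ) := by
  rw [poissonBracket_coordFun Ω χ hx, ← Ω.fderiv_apply_chartTensor χ hx]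
  congr 1
  refine Filter.EventuallyEq.fderiv_eq ?_
  filter_upwards [eventually_symm_mem_coordDomain χ hx] with z hz
  have := Ω.apply_chartTensor χ hz.2 ζ θ
  rw [(extChartAt 𝓘(ℝ, E) x₀).right_inv hz.1] at this
  exact this.symm

/-- The Jacobi identity for the Poisson tensor in a chart. -/
theorem chartTensor_jacobi {x : M} (hx : x ∈ coordDomain χ) (ξ ζ : E →L[ℝ] ℝ) :
    fderiv ℝ (Ω.chartTensor χ) (extChartAt 𝓘(ℝ, E) x₀ x)
        (Ω.chartTensor χ (extChartAt 𝓘(ℝ, E) x₀ x) ξ) ζ =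
      fderiv ℝ (Ω.chartTensor χ) (extChartAt 𝓘(ℝ, E) x₀ x)
        (Ω.chartTensor χ (extChartAt 𝓘(ℝ, E) x₀ x) ζ) ξ +
      Ω.chartTensor χ (extChartAt 𝓘(ℝ, E) x₀ x) (dualTranspose E
        ((fderiv ℝ (Ω.chartTensor χ) (extChartAt 𝓘(ℝ, E) x₀ x)).flip ξ) ζ) := by
  refine (SeparatingDual.eq_iff_forall_dual_eq (R := ℝ)).2 fun θ => ?_
  -- Tested against `θ`, the claim is Jacobi for three coordinate functions, once `h1` and `h2` use
  -- skewness to move `θ` to the outside.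
  have hj := Ω.bracketFun_jacobi (coordFun χ θ) (coordFun χ ζ) (coordFun χ ξ) x
  rw [Ω.poissonBracket_bracket_coordFun χ hx, Ω.poissonBracket_bracket_coordFun χ hx,
    Ω.poissonBracket_bracket_coordFun χ hx] at hj
  have h1 := Ω.fderiv_chartTensor_skew χ hx θ ξ (Ω.chartTensor χ (extChartAt 𝓘(ℝ, E) x₀ x) ζ)
  have h2 := Ω.apply_chartTensor_skew χ hx (dualTranspose E
        ((fderiv ℝ (Ω.chartTensor χ) (extChartAt 𝓘(ℝ, E) x₀ x)).flip ξ) ζ) θ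
  rw [dualTranspose_apply] at h2 ⊢
  have h3 : (ζ.comp ((fderiv ℝ (Ω.chartTensor χ) (extChartAt 𝓘(ℝ, E) x₀ x)).flip ξ))
      (Ω.chartTensor χ (extChartAt 𝓘(ℝ, E) x₀ x) θ) =
      ζ (fderiv ℝ (Ω.chartTensor χ) (extChartAt 𝓘(ℝ, E) x₀ x)
        (Ω.chartTensor χ (extChartAt 𝓘(ℝ, E) x₀ x) θ) ξ) := rfl
  rw [map_add, h2, h3]
  linarith

end SymplecticForm

/-! ### Integrability -/

namespace CompatibleTriple

open Set Filter Topology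

variable {E : Type u} [NormedAddCommGroup E] [NormedSpace ℝ E] [FiniteDimensional ℝ E]
  {M : Type*} [TopologicalSpace M] [ChartedSpace E M] [IsManifold 𝓘(ℝ, E) ∞ M] [T2Space M]
  {V : Type*} [NormedAddCommGroup V] [NormedSpace ℝ V] [FiniteDimensional ℝ V]
  {A : M → Type*} [TopologicalSpace (TotalSpace V A)]
  [∀ x, AddCommGroup (A x)] [∀ x, Module ℝ (A x)] [∀ x, TopologicalSpace (A x)]
  [∀ x, IsTopologicalAddGroup (A x)] [∀ x, ContinuousConstSMul ℝ (A x)]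
  [FiberBundle V A] [VectorBundle ℝ V A] [ContMDiffVectorBundle ∞ V A 𝓘(ℝ, E)]
  {𝓐 : LieAlgebroid E V A} (τ : CompatibleTriple 𝓐)

theorem isIntegrableDistribution_Λ : IsIntegrableDistribution τ.Λ := by
  intro x₀
  let χ : SmoothBumpFunction 𝓘(ℝ, E) x₀ := Classical.arbitrary _
  let c := extChartAt 𝓘(ℝ, E) x₀
  have hx₀ : x₀ ∈ coordDomain χ := mem_of_mem_nhds (coordDomain_mem_nhds χ)
  -- The local theorem needs a globally smooth tensor. On `U` the extension has the germ of the
  -- chart tensor, so derivatives, and hence Jacobi, agree too.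
  obtain ⟨B, hB, hBeq⟩ := exists_contDiff_eventuallyEq (isOpen_extChartAt_target x₀)
    (c.map_source hx₀.1) (τ.Ω.contDiffOn_chartTensor χ)
  let U : Set E := {z | (z ∈ c.target ∧ c.symm z ∈ coordDomain χ) ∧ B =ᶠ[𝓝 z] τ.Ω.chartTensor χ}
  have hU : U ∈ 𝓝 (c x₀) :=
    inter_mem (eventually_symm_mem_coordDomain χ hx₀) hBeq.eventually_nhds
  have hJ : ∀ z ∈ U, ∀ ξ ζ, fderiv ℝ B z (B z ξ) ζ =
      fderiv ℝ B z (B z ζ) ξ + B z (dualTranspose E ((fderiv ℝ B z).flip ξ) ζ) := by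
    rintro z ⟨⟨hz, hx⟩, hBz⟩ ξ ζ
    have := τ.Ω.chartTensor_jacobi χ hx ξ ζ
    rw [c.right_inv hz] at this
    rw [hBz.fderiv_eq, hBz.eq_of_nhds]
    exact this
  obtain ⟨k, φ, hφ, hinj, hφ0, hφU⟩ := exists_integral_immersion hB norm_dualTranspose_le
    (by ext; rfl) (fun S T => by ext; rfl) hU hJ
  have hι : ContMDiff 𝓘(ℝ, EuclideanSpace ℝ (Fin k)) 𝓘(ℝ, E) ∞ (fun w => c.symm (φ w)) :=
    fun w => ((contMDiffOn_extChartAt_symm x₀).contMDiffAt ((isOpen_extChartAt_target x₀).mem_nhds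
      (hφU w).1.1.1)).comp w hφ.contMDiff.contMDiffAt
  have hd : ∀ w u, mvfderiv 𝓘(ℝ, E) c (c.symm (φ w))
      (mfderiv 𝓘(ℝ, EuclideanSpace ℝ (Fin k)) 𝓘(ℝ, E) (fun w => c.symm (φ w)) w u) =
      fderiv ℝ φ w u := by
    intro w u
    have hd : MDifferentiableAt 𝓘(ℝ, E) 𝓘(ℝ, E) c (c.symm (φ w)) :=
      mdifferentiableAt_extChartAt (by simpa using (hφU w).1.1.2.1)
    have h := mfderiv_comp w hd (hι.mdifferentiable (by simp) w)
    have heq : (c ∘ fun w => c.symm (φ w)) = φ := funext fun w => c.right_inv (hφU w).1.1.1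
    rw [heq, mfderiv_eq_fderiv] at h
    exact (DFunLike.congr_fun h u).symm
  refine ⟨k, EuclideanSpace ℝ (Fin k), inferInstance, inferInstance, inferInstance, inferInstance,
    inferInstance, inferInstance, fun w => c.symm (φ w), ⟨hι, ?_, ?_, ?_⟩, 0, ?_⟩
  · intro w w' h
    exact hinj (c.symm.injOn (hφU w).1.1.1 (hφU w').1.1.1 h)
  · intro w u u' h
    refine (hφU w).2.1 ?_
    rw [← hd, ← hd, h]
  · intro w
    have hx := (hφU w).1.1.2
    have hcinj := mvfderiv_extChartAt_injective hx.1
    have hT : ∀ ξ, mvfderiv 𝓘(ℝ, E) c (c.symm (φ w))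
        (𝓐.anchor _ (τ.Ω.hamiltonian (coordFun χ ξ) (c.symm (φ w)))) = B (φ w) ξ := by
      intro ξ
      have := τ.Ω.mvfderiv_extChartAt_hamiltonian χ hx ξ
      rw [c.right_inv (hφU w).1.1.1] at this
      rw [(hφU w).1.2.eq_of_nhds]
      exact this
    ext v
    rw [τ.mem_Λ_iff_coordFun χ hx]
    constructor
    · rintro ⟨u, rfl⟩
      have : fderiv ℝ φ w u ∈ LinearMap.range (B (φ w)).toLinearMap := by
        rw [← (hφU w).2.2]
        exact ⟨u, rfl⟩
      obtain ⟨ξ, hξ⟩ := this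
      refine ⟨ξ, hcinj ?_⟩
      exact (hT ξ).trans (hξ.trans (hd w u).symm)
    · rintro ⟨ξ, rfl⟩
      have : B (φ w) ξ ∈ LinearMap.range (fderiv ℝ φ w).toLinearMap := by
        rw [(hφU w).2.2]
        exact ⟨ξ, rfl⟩
      obtain ⟨u, hu⟩ := this
      refine ⟨u, hcinj ?_⟩
      exact (hd w u).trans (hu.trans (hT ξ).symm)
  · change c.symm (φ 0) = x₀
    rw [hφ0]
    exact c.left_inv hx₀.1

end CompatibleTriple

/-! ### Exterior derivative of a 2-form on a manifold -/

section TwoForms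

variable {F : Type*} [NormedAddCommGroup F] [NormedSpace ℝ F] [FiniteDimensional ℝ F]
  {O : Type*} [TopologicalSpace O] [ChartedSpace F O] [IsManifold 𝓘(ℝ, F) ∞ O]
  (η : ∀ p : O, TangentSpace 𝓘(ℝ, F) p →L[ℝ] TangentSpace 𝓘(ℝ, F) p →L[ℝ] ℝ)

/-- The exterior derivative of a 2-form, evaluated on arbitrary vector fields. -/
noncomputable def extDerivTwo (X Y Z : ∀ p : O, TangentSpace 𝓘(ℝ, F) p) (p : O) : ℝ :=
  mvfderiv 𝓘(ℝ, F) (fun q => η q (Y q) (Z q)) p (X p)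
    - mvfderiv 𝓘(ℝ, F) (fun q => η q (X q) (Z q)) p (Y p)
    + mvfderiv 𝓘(ℝ, F) (fun q => η q (X q) (Y q)) p (Z p)
    - η p (mlieBracket 𝓘(ℝ, F) X Y p) (Z p)
    + η p (mlieBracket 𝓘(ℝ, F) X Z p) (Y p)
    - η p (mlieBracket 𝓘(ℝ, F) Y Z p) (X p)

theorem tangentLieAlgebroid_d₂
    (S T U : Cₛ^∞⟮𝓘(ℝ, F); F, (TangentSpace 𝓘(ℝ, F) : O → Type _)⟯) (p : O) :
    (tangentLieAlgebroid F O).d₂ η S T U p = extDerivTwo η S T U p := rfl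

variable {η}

theorem twoForm_skew (halt : ∀ p a, η p a a = 0) (p : O) (a b : TangentSpace 𝓘(ℝ, F) p) : η p a b = -η p b a := by
  have h := halt p (a + b)
  simp only [map_add, add_apply, halt, zero_add, add_zero] at h
  linarith

theorem mvfderiv_twoForm_skew (halt : ∀ p a, η p a a = 0)
    (X Y : ∀ p : O, TangentSpace 𝓘(ℝ, F) p) (p : O)
    (v : TangentSpace 𝓘(ℝ, F) p) :
    mvfderiv 𝓘(ℝ, F) (fun q => η q (X q) (Y q)) p v =
      -mvfderiv 𝓘(ℝ, F) (fun q => η q (Y q) (X q)) p v := by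
  rw [show (fun q => η q (X q) (Y q)) = fun q => -η q (Y q) (X q) from
    funext fun q => twoForm_skew halt _ _ _, mvfderiv_fun_neg]
  simp

theorem extDerivTwo_swap_left (halt : ∀ p a, η p a a = 0)
    (X Y Z : ∀ p : O, TangentSpace 𝓘(ℝ, F) p) (p : O) :
    extDerivTwo η X Y Z p = -extDerivTwo η Y X Z p := by
  rw [extDerivTwo, extDerivTwo, mvfderiv_twoForm_skew halt X Y, mlieBracket_swap_apply (V := X),
    map_neg, neg_apply]
  ring

theorem extDerivTwo_swap_right (halt : ∀ p a, η p a a = 0)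
    (X Y Z : ∀ p : O, TangentSpace 𝓘(ℝ, F) p) (p : O) :
    extDerivTwo η X Y Z p = -extDerivTwo η X Z Y p := by
  rw [extDerivTwo, extDerivTwo, mvfderiv_twoForm_skew halt Y Z,
    mlieBracket_swap_apply (V := Y) (W := Z), map_neg, neg_apply]
  ring

theorem mdifferentiableAt_twoForm_apply
    (hη : ContMDiff 𝓘(ℝ, F) (𝓘(ℝ, F).prod 𝓘(ℝ, F →L[ℝ] F →L[ℝ] ℝ)) ∞
      (fun p => TotalSpace.mk' (F →L[ℝ] F →L[ℝ] ℝ) p (η p)))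
    {X Y : ∀ p : O, TangentSpace 𝓘(ℝ, F) p} {p : O}
    (hX : MDifferentiableAt 𝓘(ℝ, F) 𝓘(ℝ, F).tangent
      (fun q => (⟨q, X q⟩ : TangentBundle 𝓘(ℝ, F) O)) p)
    (hY : MDifferentiableAt 𝓘(ℝ, F) 𝓘(ℝ, F).tangent
      (fun q => (⟨q, Y q⟩ : TangentBundle 𝓘(ℝ, F) O)) p) :
    MDifferentiableAt 𝓘(ℝ, F) 𝓘(ℝ, ℝ) (fun q => η q (X q) (Y q)) p := by
  have h := MDifferentiableAt.clm_bundle_apply₂ (F₁ := F) (F₂ := F) (F₃ := ℝ)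
    (E₃ := Bundle.Trivial O ℝ) (hη.mdifferentiable (by simp) p) hX hY
  simp only [mdifferentiableAt_totalSpace] at h
  exact h.2

/-- The derivatives of `f` produced by the function terms cancel those produced by the Lie brackets.
The other two slots follow by alternation. -/
theorem tensorialAt_extDerivTwo
    (hη : ContMDiff 𝓘(ℝ, F) (𝓘(ℝ, F).prod 𝓘(ℝ, F →L[ℝ] F →L[ℝ] ℝ)) ∞
      (fun p => TotalSpace.mk' (F →L[ℝ] F →L[ℝ] ℝ) p (η p)))
    {Y Z : ∀ p : O, TangentSpace 𝓘(ℝ, F) p} {p : O}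
    (hY : MDifferentiableAt 𝓘(ℝ, F) 𝓘(ℝ, F).tangent
      (fun q => (⟨q, Y q⟩ : TangentBundle 𝓘(ℝ, F) O)) p)
    (hZ : MDifferentiableAt 𝓘(ℝ, F) 𝓘(ℝ, F).tangent
      (fun q => (⟨q, Z q⟩ : TangentBundle 𝓘(ℝ, F) O)) p) :
    TensorialAt 𝓘(ℝ, F) F (fun X => extDerivTwo η X Y Z p) p := by
  have : CompleteSpace F := FiniteDimensional.complete ℝ F
  constructor
  · intro f X hf hX
    have h : ∀ W : (∀ q : O, TangentSpace 𝓘(ℝ, F) q),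
        MDifferentiableAt 𝓘(ℝ, F) 𝓘(ℝ, F).tangent
          (fun q => (⟨q, W q⟩ : TangentBundle 𝓘(ℝ, F) O)) p → ∀ v,
        mvfderiv 𝓘(ℝ, F) (fun q => η q ((f • X) q) (W q)) p v =
          f p * mvfderiv 𝓘(ℝ, F) (fun q => η q (X q) (W q)) p v +
            η p (X p) (W p) * mvfderiv 𝓘(ℝ, F) f p v := by
      intro W hW v
      have e : (fun q => η q ((f • X) q) (W q)) = f * fun q => η q (X q) (W q) := by
        ext q; simp
      rw [e, mvfderiv_mul hf (mdifferentiableAt_twoForm_apply hη hX hW)]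
      simp
    rw [extDerivTwo, h Z hZ, h Y hY, mlieBracket_smul_left hf hX, mlieBracket_smul_left hf hX]
    simp only [extDerivTwo, Pi.smul_apply', map_smul, map_add, add_apply, smul_apply, smul_eq_mul]
    ring
  · intro X X' hX hX'
    have h : ∀ W : (∀ q : O, TangentSpace 𝓘(ℝ, F) q),
        MDifferentiableAt 𝓘(ℝ, F) 𝓘(ℝ, F).tangent
          (fun q => (⟨q, W q⟩ : TangentBundle 𝓘(ℝ, F) O)) p → ∀ v,
        mvfderiv 𝓘(ℝ, F) (fun q => η q ((X + X') q) (W q)) p v =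
          mvfderiv 𝓘(ℝ, F) (fun q => η q (X q) (W q)) p v +
            mvfderiv 𝓘(ℝ, F) (fun q => η q (X' q) (W q)) p v := by
      intro W hW v
      have e : (fun q => η q ((X + X') q) (W q)) =
          (fun q => η q (X q) (W q)) + fun q => η q (X' q) (W q) := by
        ext q; simp
      rw [e, mvfderiv_add (mdifferentiableAt_twoForm_apply hη hX hW)
        (mdifferentiableAt_twoForm_apply hη hX' hW), add_apply]
    rw [extDerivTwo, h Z hZ, h Y hY, mlieBracket_add_left hX hX', mlieBracket_add_left hX hX']
    simp only [extDerivTwo, Pi.add_apply, map_add, add_apply]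
    ring

/-- The exterior derivative of a 2-form depends only on the values of the vector fields. -/
theorem extDerivTwo_congr (halt : ∀ p a, η p a a = 0)
    (hη : ContMDiff 𝓘(ℝ, F) (𝓘(ℝ, F).prod 𝓘(ℝ, F →L[ℝ] F →L[ℝ] ℝ)) ∞
      (fun p => TotalSpace.mk' (F →L[ℝ] F →L[ℝ] ℝ) p (η p)))
    {S S' T T' U U' : Cₛ^∞⟮𝓘(ℝ, F); F, (TangentSpace 𝓘(ℝ, F) : O → Type _)⟯} {p : O}
    (hS : S p = S' p) (hT : T p = T' p) (hU : U p = U' p) :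
    extDerivTwo η S T U p = extDerivTwo η S' T' U' p := by
  have h := fun S => mdifferentiableAt_vectorField (E := F) (M := O) S p
  have key : ∀ {S S' : Cₛ^∞⟮𝓘(ℝ, F); F, (TangentSpace 𝓘(ℝ, F) : O → Type _)⟯}
      (T U : Cₛ^∞⟮𝓘(ℝ, F); F, (TangentSpace 𝓘(ℝ, F) : O → Type _)⟯), S p = S' p →
      extDerivTwo η S T U p = extDerivTwo η S' T U p := fun {S S'} T U hSS' =>
    (tensorialAt_extDerivTwo hη (h T) (h U)).pointwise (h S) (h S') hSS'
  rw [key T U hS, extDerivTwo_swap_left halt, key S' U hT, extDerivTwo_swap_left halt, neg_neg,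
    extDerivTwo_swap_right halt, extDerivTwo_swap_left halt, key S' T' hU,
    extDerivTwo_swap_left halt, neg_neg, extDerivTwo_swap_right halt, neg_neg]

end TwoForms

namespace SymplecticForm

variable {E : Type*} [NormedAddCommGroup E] [NormedSpace ℝ E]
  {M : Type*} [TopologicalSpace M] [ChartedSpace E M] [IsManifold 𝓘(ℝ, E) ∞ M]
  {V : Type*} [NormedAddCommGroup V] [NormedSpace ℝ V] [FiniteDimensional ℝ V]
  {A : M → Type*} [TopologicalSpace (TotalSpace V A)]
  [∀ x, AddCommGroup (A x)] [∀ x, Module ℝ (A x)] [∀ x, TopologicalSpace (A x)]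
  [∀ x, IsTopologicalAddGroup (A x)] [∀ x, ContinuousConstSMul ℝ (A x)]
  [FiberBundle V A] [VectorBundle ℝ V A]
  {𝓐 : LieAlgebroid E V A} (Ω : SymplecticForm 𝓐)

/-- On the orthogonal of the isotropy the form descends along the anchor. -/
theorem form_congr_of_mem_orth_L {x : M} {a a' b b' : A x} (ha' : a' ∈ Ω.orth x (𝓐.L x))
    (hb : b ∈ Ω.orth x (𝓐.L x)) (haa' : 𝓐.anchor x a = 𝓐.anchor x a')
    (hbb' : 𝓐.anchor x b = 𝓐.anchor x b') : Ω.form x a b = Ω.form x a' b' := by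
  -- `Ω(a, b) = Ω(a', b)` because `b ∈ L^Ω`, and `Ω(a', b) = Ω(a', b')` because `a' ∈ L^Ω`; thus `a`
  -- and `b'` may be any lifts.
  have h1 : a - a' ∈ 𝓐.L x := by
    change 𝓐.anchor x (a - a') = 0
    rw [map_sub, haa', sub_self]
  have h2 : b - b' ∈ 𝓐.L x := by
    change 𝓐.anchor x (b - b') = 0
    rw [map_sub, hbb', sub_self]
  have h3 := hb _ h1
  have h4 := ha' _ h2
  rw [Ω.skew, map_sub, sub_apply] at h3
  rw [map_sub] at h4
  linarith

end SymplecticForm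

/-! ### The symplectic form on an integral submanifold -/

namespace IsIntegralSubmanifold

variable {E : Type*} [NormedAddCommGroup E] [NormedSpace ℝ E] [FiniteDimensional ℝ E]
  {M : Type*} [TopologicalSpace M] [ChartedSpace E M] [IsManifold 𝓘(ℝ, E) ∞ M] [T2Space M]
  {V : Type*} [NormedAddCommGroup V] [NormedSpace ℝ V] [FiniteDimensional ℝ V]
  {A : M → Type*} [TopologicalSpace (TotalSpace V A)]
  [∀ x, AddCommGroup (A x)] [∀ x, Module ℝ (A x)] [∀ x, TopologicalSpace (A x)]
  [∀ x, IsTopologicalAddGroup (A x)] [∀ x, ContinuousConstSMul ℝ (A x)]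
  [FiberBundle V A] [VectorBundle ℝ V A]
  {𝓐 : LieAlgebroid E V A} {τ : CompatibleTriple 𝓐}
  {F : Type*} [NormedAddCommGroup F] [NormedSpace ℝ F] [FiniteDimensional ℝ F]
  {O : Type*} [TopologicalSpace O] [ChartedSpace F O] [IsManifold 𝓘(ℝ, F) ∞ O]
  {ι : O → M}

/-- A linear choice of lifts of tangent vectors to the orthogonal of the isotropy. -/
theorem exists_lift (hι : IsIntegralSubmanifold (F := F) τ.Λ ι) (p : O) : ∃ s : TangentSpace 𝓘(ℝ, F) p →ₗ[ℝ] A (ι p),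
    (∀ v, s v ∈ τ.Ω.orth (ι p) (𝓐.L (ι p))) ∧
    ∀ v, 𝓐.anchor (ι p) (s v) = mfderiv 𝓘(ℝ, F) 𝓘(ℝ, E) ι p v := by
  have : Module.Free ℝ (TangentSpace 𝓘(ℝ, F) p) := inferInstanceAs (Module.Free ℝ F)
  let q := (𝓐.anchor (ι p)).toLinearMap.restrict (p := τ.Ω.orth (ι p) (𝓐.L (ι p)))
    (q := τ.Λ (ι p)) fun a ha => τ.mem_Λ.2 ⟨a, ha, rfl⟩
  let d := (mfderiv 𝓘(ℝ, F) 𝓘(ℝ, E) ι p).toLinearMap.codRestrict (τ.Λ (ι p)) fun v => by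
    rw [← hι.range_mfderiv p]
    exact ⟨v, rfl⟩
  obtain ⟨s, hs⟩ := Module.projective_lifting_property q d fun v => by
    obtain ⟨a, ha, hav⟩ := τ.mem_Λ.1 v.2
    exact ⟨⟨a, ha⟩, Subtype.ext hav⟩
  exact ⟨(Submodule.subtype _).comp s, fun v => (s v).2,
    fun v => congrArg Subtype.val (LinearMap.congr_fun hs v)⟩

theorem exists_hamiltonianField (hι : IsIntegralSubmanifold (F := F) τ.Λ ι)
    (f : C^∞⟮𝓘(ℝ, E), M; ℝ⟯) (p : O) :
    ∃ v : TangentSpace 𝓘(ℝ, F) p, mfderiv 𝓘(ℝ, F) 𝓘(ℝ, E) ι p v =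
      𝓐.anchor (ι p) (τ.Ω.hamiltonian f (ι p)) := by
  have h : 𝓐.anchor (ι p) (τ.Ω.hamiltonian f (ι p)) ∈
      LinearMap.range (mfderiv 𝓘(ℝ, F) 𝓘(ℝ, E) ι p).toLinearMap := by
    rw [hι.range_mfderiv p]
    exact τ.mem_Λ.2 ⟨_, τ.Ω.hamiltonian_mem_orth_L f _, rfl⟩
  exact h

variable (hι : IsIntegralSubmanifold (F := F) τ.Λ ι)

/-- The restriction of a smooth function to an integral submanifold. -/
noncomputable def restrict (f : C^∞⟮𝓘(ℝ, E), M; ℝ⟯) : C^∞⟮𝓘(ℝ, F), O; ℝ⟯ := f.comp ⟨ι, hι.contMDiff⟩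

theorem mvfderiv_restrict (f : C^∞⟮𝓘(ℝ, E), M; ℝ⟯) (p : O) (v : TangentSpace 𝓘(ℝ, F) p) :
    mvfderiv 𝓘(ℝ, F) (hι.restrict f) p v =
      mvfderiv 𝓘(ℝ, E) f (ι p) (mfderiv 𝓘(ℝ, F) 𝓘(ℝ, E) ι p v) := by
  have h := mfderiv_comp p (f.contMDiff.mdifferentiable (by simp) (ι p))
    (hι.contMDiff.mdifferentiable (by simp) p)
  exact DFunLike.congr_fun h v

/-- The vector field on an integral submanifold induced by a Hamiltonian section. -/
noncomputable def hamiltonianField (f : C^∞⟮𝓘(ℝ, E), M; ℝ⟯) (p : O) : TangentSpace 𝓘(ℝ, F) p :=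
  (hι.exists_hamiltonianField f p).choose

theorem mfderiv_hamiltonianField (f : C^∞⟮𝓘(ℝ, E), M; ℝ⟯) (p : O) :
    mfderiv 𝓘(ℝ, F) 𝓘(ℝ, E) ι p (hι.hamiltonianField f p) =
      𝓐.anchor (ι p) (τ.Ω.hamiltonian f (ι p)) :=
  (hι.exists_hamiltonianField f p).choose_spec

theorem mvfderiv_restrict_hamiltonianField (f h : C^∞⟮𝓘(ℝ, E), M; ℝ⟯) (p : O) :
    mvfderiv 𝓘(ℝ, F) (hι.restrict f) p (hι.hamiltonianField h p) =
      τ.Ω.poissonBracket f h (ι p) := by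
  rw [mvfderiv_restrict, mfderiv_hamiltonianField, SymplecticForm.poissonBracket_apply]

/-- This lets pointwise questions about the induced form be settled on Hamiltonian fields. -/
theorem exists_hamiltonianField_eq (p : O) (v : TangentSpace 𝓘(ℝ, F) p) :
    ∃ f : C^∞⟮𝓘(ℝ, E), M; ℝ⟯, hι.hamiltonianField f p = v := by
  let χ : SmoothBumpFunction 𝓘(ℝ, E) (ι p) := Classical.arbitrary _
  have hv : mfderiv 𝓘(ℝ, F) 𝓘(ℝ, E) ι p v ∈ τ.Λ (ι p) := by
    rw [← hι.range_mfderiv p]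
    exact ⟨v, rfl⟩
  obtain ⟨ξ, hξ⟩ :=
    (τ.mem_Λ_iff_coordFun χ (mem_of_mem_nhds (coordDomain_mem_nhds χ))).1 hv
  exact ⟨_, hι.immersion p ((hι.mfderiv_hamiltonianField _ p).trans hξ)⟩

/-- Functions restricted from the ambient manifold separate tangent vectors. -/
theorem eq_zero_of_mvfderiv_restrict {p : O} {v : TangentSpace 𝓘(ℝ, F) p}
    (χ : SmoothBumpFunction 𝓘(ℝ, E) (ι p))
    (hv : ∀ j, mvfderiv 𝓘(ℝ, F) (hι.restrict (coordFun χ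
      (LinearMap.toContinuousLinearMap ((Module.finBasis ℝ E).coord j)))) p v = 0) : v = 0 := by
  have hp := mem_of_mem_nhds (coordDomain_mem_nhds χ)
  refine hι.immersion p (mvfderiv_extChartAt_injective hp.1 ?_)
  rw [map_zero, map_zero]
  refine (Module.finBasis ℝ E).ext_elem fun j => ?_
  have h := hv j
  rw [mvfderiv_restrict, mvfderiv_coordFun χ hp] at h
  rw [map_zero, Finsupp.zero_apply]
  exact h

/-- The form induced on an integral submanifold, at a point. -/
noncomputable def inducedForm (p : O) :
    TangentSpace 𝓘(ℝ, F) p →L[ℝ] TangentSpace 𝓘(ℝ, F) p →L[ℝ] ℝ :=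
  have : ContinuousSMul ℝ (A (ι p)) :=
    (VectorBundle.continuousLinearEquivAt ℝ V A (ι p)).continuousSMul
  let s : F →L[ℝ] A (ι p) := LinearMap.toContinuousLinearMap (hι.exists_lift p).choose
  (ContinuousLinearMap.precomp ℝ s).comp ((τ.Ω.form (ι p)).comp s)

theorem inducedForm_apply {p : O} {u v : TangentSpace 𝓘(ℝ, F) p} {a b : A (ι p)}
    (ha : a ∈ τ.Ω.orth (ι p) (𝓐.L (ι p)))
    (hau : 𝓐.anchor (ι p) a = mfderiv 𝓘(ℝ, F) 𝓘(ℝ, E) ι p u)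
    (hbv : 𝓐.anchor (ι p) b = mfderiv 𝓘(ℝ, F) 𝓘(ℝ, E) ι p v) :
    hι.inducedForm p u v = τ.Ω.form (ι p) a b := by
  obtain ⟨h1, h2⟩ := (hι.exists_lift p).choose_spec
  exact τ.Ω.form_congr_of_mem_orth_L ha (h1 v) ((h2 u).trans hau.symm) ((h2 v).trans hbv.symm)

theorem inducedForm_self (p : O) (v : TangentSpace 𝓘(ℝ, F) p) : hι.inducedForm p v v = 0 :=
  τ.Ω.alternating _ _

/-- For a lift `b` of `v`, `Ω(a_f, b) = df(ρ(b)) = df(dι(v))`. So the field induced by `a_f` is the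
Hamiltonian field of `f|_O`. -/
theorem inducedForm_hamiltonianField (f : C^∞⟮𝓘(ℝ, E), M; ℝ⟯) (p : O)
    (v : TangentSpace 𝓘(ℝ, F) p) :
    hι.inducedForm p (hι.hamiltonianField f p) v = mvfderiv 𝓘(ℝ, F) (hι.restrict f) p v := by
  obtain ⟨s, hs, hs'⟩ := hι.exists_lift p
  rw [hι.inducedForm_apply (τ.Ω.hamiltonian_mem_orth_L f _)
    (hι.mfderiv_hamiltonianField f p).symm (hs' v), SymplecticForm.form_hamiltonian,
    mvfderiv_restrict, ← hs']
  rfl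

theorem inducedForm_nondegenerate {p : O} {v : TangentSpace 𝓘(ℝ, F) p}
    (hv : ∀ w, hι.inducedForm p v w = 0) : v = 0 := by
  refine hι.eq_zero_of_mvfderiv_restrict (Classical.arbitrary _) fun j => ?_
  rw [← inducedForm_hamiltonianField, twoForm_skew hι.inducedForm_self, hv, neg_zero]

variable [ContMDiffVectorBundle ∞ V A 𝓘(ℝ, E)]

/-- The restricted coordinate functions have injective joint differential, and their derivatives
along the field are brackets on `M` composed with `ι`. -/
theorem contMDiff_hamiltonianField (f : C^∞⟮𝓘(ℝ, E), M; ℝ⟯) :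
    ContMDiff 𝓘(ℝ, F) 𝓘(ℝ, F).tangent ∞
      (fun p => (⟨p, hι.hamiltonianField f p⟩ : TangentBundle 𝓘(ℝ, F) O)) := by
  intro p₀
  let χ : SmoothBumpFunction 𝓘(ℝ, E) (ι p₀) := Classical.arbitrary _
  let c := fun j => coordFun χ (LinearMap.toContinuousLinearMap ((Module.finBasis ℝ E).coord j))
  refine contMDiffAt_section_of_linearForms (V := F) (A := (TangentSpace 𝓘(ℝ, F) : O → Type _))
    (hι.hamiltonianField f)
    (fun j p => (mvfderiv 𝓘(ℝ, F) (hι.restrict (c j)) p).toLinearMap) ?_ ?_ ?_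
  · intro j t ht
    exact contMDiffAt_mvfderiv_apply _ ht
  · intro a ha
    exact hι.eq_zero_of_mvfderiv_restrict χ ha
  · intro j
    refine ((τ.Ω.contMDiff_poissonBracket (c j) f).comp hι.contMDiff p₀).congr_of_eventuallyEq
      (.of_forall fun p => ?_)
    exact hι.mvfderiv_restrict_hamiltonianField _ _ _

-- Choose Hamiltonian fields forming a basis at `p₀`. Evaluation on pairs of them determines a
-- bilinear form at `p₀`, and the values on the induced form are brackets on `M` composed with `ι`.
set_option synthInstance.maxHeartbeats 400000 in
theorem contMDiff_inducedForm :
    ContMDiff 𝓘(ℝ, F) (𝓘(ℝ, F).prod 𝓘(ℝ, F →L[ℝ] F →L[ℝ] ℝ)) ∞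
      (fun p => TotalSpace.mk' (F →L[ℝ] F →L[ℝ] ℝ) p (hι.inducedForm p)) := by
  intro p₀
  let b : Module.Basis _ ℝ (TangentSpace 𝓘(ℝ, F) p₀) := Module.finBasis ℝ F
  choose f hf using fun i => hι.exists_hamiltonianField_eq p₀ (b i)
  refine contMDiffAt_section_of_linearForms (V := F →L[ℝ] F →L[ℝ] ℝ)
    (A := fun p : O => TangentSpace 𝓘(ℝ, F) p →L[ℝ] TangentSpace 𝓘(ℝ, F) p →L[ℝ] ℝ)
    hι.inducedForm (κ := Fin (Module.finrank ℝ F) × Fin (Module.finrank ℝ F))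
    (fun ij p =>
      { toFun := fun η => η (hι.hamiltonianField (f ij.1) p) (hι.hamiltonianField (f ij.2) p)
        map_add' := fun _ _ => rfl
        map_smul' := fun _ _ => rfl }) ?_ ?_ ?_
  · intro ij t ht
    have h := ContMDiffAt.clm_bundle_apply₂ (F₁ := F) (F₂ := F) (F₃ := ℝ)
      (E₃ := Bundle.Trivial O ℝ) ht (hι.contMDiff_hamiltonianField (f ij.1) p₀)
      (hι.contMDiff_hamiltonianField (f ij.2) p₀)
    simp only [Bundle.contMDiffAt_section, Bundle.Trivial.fiberBundle_trivializationAt',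
      Bundle.Trivial.trivialization_apply] at h
    exact h
  · intro η hη
    have h : ∀ i j, η (b i) (b j) = 0 := fun i j => by
      rw [← hf, ← hf]
      exact hη (i, j)
    ext u v
    have h1 : ∀ i, (η (b i)).toLinearMap = 0 := fun i => b.ext fun j => h i j
    have h2 : (LinearMap.applyₗ v).comp (ContinuousLinearMap.coeLM ℝ ∘ₗ η.toLinearMap) = 0 :=
      b.ext fun i => LinearMap.congr_fun (h1 i) v
    exact LinearMap.congr_fun h2 u
  · intro ij
    refine ((τ.Ω.contMDiff_poissonBracket (f ij.1) (f ij.2)).comp hι.contMDiff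
      p₀).congr_of_eventuallyEq (.of_forall fun p => ?_)
    exact (hι.inducedForm_hamiltonianField _ p _).trans
      (hι.mvfderiv_restrict_hamiltonianField _ _ p)

/-- The vector field induced by a Hamiltonian section, as a smooth section. -/
noncomputable def hamiltonianSection (f : C^∞⟮𝓘(ℝ, E), M; ℝ⟯) :
    Cₛ^∞⟮𝓘(ℝ, F); F, (TangentSpace 𝓘(ℝ, F) : O → Type _)⟯ :=
  ⟨hι.hamiltonianField f, hι.contMDiff_hamiltonianField f⟩

/-- By tensoriality the three fields may be replaced by Hamiltonian ones with the same values at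
`p`; the derivative is then minus the Jacobi sum of the bracket on `M` at `ι p`. -/
theorem inducedForm_closed
    (S T U : Cₛ^∞⟮𝓘(ℝ, F); F, (TangentSpace 𝓘(ℝ, F) : O → Type _)⟯) (p : O) :
    (tangentLieAlgebroid F O).d₂ hι.inducedForm S T U p = 0 := by
  obtain ⟨f, hf⟩ := hι.exists_hamiltonianField_eq p (S p)
  obtain ⟨h, hh⟩ := hι.exists_hamiltonianField_eq p (T p)
  obtain ⟨k, hk⟩ := hι.exists_hamiltonianField_eq p (U p)
  rw [tangentLieAlgebroid_d₂, extDerivTwo_congr hι.inducedForm_self hι.contMDiff_inducedForm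
    (S' := hι.hamiltonianSection f) (T' := hι.hamiltonianSection h)
    (U' := hι.hamiltonianSection k) hf.symm hh.symm hk.symm, ← tangentLieAlgebroid_d₂]
  have hd : ∀ (f : C^∞⟮𝓘(ℝ, E), M; ℝ⟯) (q : O) (v : TangentSpace 𝓘(ℝ, F) q),
      (tangentLieAlgebroid F O).d₀ (hι.restrict f) q v =
        hι.inducedForm q (hι.hamiltonianSection f q) v := fun f q v =>
    (hι.inducedForm_hamiltonianField f q v).symm
  rw [(tangentLieAlgebroid F O).d₂_of_hamiltonian hι.inducedForm hι.inducedForm_self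
    (f := hι.restrict f) (h := hι.restrict h) (k := hι.restrict k) (hd f) (hd h) (hd k)]
  have key : ∀ f h k : C^∞⟮𝓘(ℝ, E), M; ℝ⟯, mvfderiv 𝓘(ℝ, F)
      (fun q => hι.inducedForm q (hι.hamiltonianSection h q) (hι.hamiltonianSection k q)) p
      (hι.hamiltonianSection f p) = τ.Ω.poissonBracket (τ.Ω.bracketFun h k) f (ι p) := by
    intro f h k
    have heq : (fun q => hι.inducedForm q (hι.hamiltonianSection h q)
        (hι.hamiltonianSection k q)) = hι.restrict (τ.Ω.bracketFun h k) := funext fun q =>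
      (hι.inducedForm_hamiltonianField _ q _).trans (hι.mvfderiv_restrict_hamiltonianField _ _ q)
    rw [heq]
    exact hι.mvfderiv_restrict_hamiltonianField _ _ p
  have hj := τ.Ω.bracketFun_jacobi h k f (ι p)
  rw [← key f h k, ← key h k f, ← key k f h] at hj
  exact neg_eq_zero.2 hj

/-- The symplectic form induced on an integral submanifold. -/
noncomputable def inducedSymplecticForm : SymplecticForm (tangentLieAlgebroid F O) where
  form := hι.inducedForm
  contMDiff := hι.contMDiff_inducedForm
  alternating := hι.inducedForm_self
  nondegenerate _ _ := hι.inducedForm_nondegenerate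
  closed := hι.inducedForm_closed

theorem isInducedForm_inducedSymplecticForm : IsInducedForm τ ι hι.inducedSymplecticForm := by
  intro p X Y a ha b _ haX hbY
  rw [τ.E₂_sup_L₁] at ha
  exact hι.inducedForm_apply ha haX hbY

theorem eq_inducedSymplecticForm {ΩO : SymplecticForm (tangentLieAlgebroid F O)}
    (hΩO : IsInducedForm τ ι ΩO) : ΩO = hι.inducedSymplecticForm := by
  ext p X Y
  obtain ⟨s, hs, hs'⟩ := hι.exists_lift p
  rw [hΩO p X Y (s X) (by rw [τ.E₂_sup_L₁]; exact hs X) (s Y)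
    (by rw [τ.E₂_sup_L₁]; exact hs Y) (hs' X) (hs' Y)]
  exact (hι.inducedForm_apply (hs X) (hs' X) (hs' Y)).symm

theorem poissonBracket_inducedForm (f h : C^∞⟮𝓘(ℝ, E), M; ℝ⟯) (p : O) :
    hι.inducedSymplecticForm.poissonBracket (hι.restrict f) (hι.restrict h) p =
      τ.Ω.poissonBracket f h (ι p) := by
  have hH : ∀ f, hι.inducedSymplecticForm.hamiltonian (hι.restrict f) p =
      hι.hamiltonianField f p := fun f =>
    (hι.inducedSymplecticForm.eq_hamiltonian fun v =>
      (hι.inducedForm_hamiltonianField f p v).symm).symm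
  rw [SymplecticForm.poissonBracket, hH, hH]
  exact (hι.inducedForm_hamiltonianField _ p _).trans (hι.mvfderiv_restrict_hamiltonianField _ _ p)

end IsIntegralSubmanifold

theorem mainTheorem2
    {E : Type*} [NormedAddCommGroup E] [NormedSpace ℝ E] [FiniteDimensional ℝ E]
    {M : Type*} [TopologicalSpace M] [ChartedSpace E M] [IsManifold 𝓘(ℝ, E) ∞ M]
    [T2Space M] [SecondCountableTopology M]
    {V : Type*} [NormedAddCommGroup V] [NormedSpace ℝ V] [FiniteDimensional ℝ V]
    {A : M → Type*} [TopologicalSpace (TotalSpace V A)]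
    [∀ x, AddCommGroup (A x)] [∀ x, Module ℝ (A x)] [∀ x, TopologicalSpace (A x)]
    [∀ x, IsTopologicalAddGroup (A x)] [∀ x, ContinuousConstSMul ℝ (A x)]
    [FiberBundle V A] [VectorBundle ℝ V A] [ContMDiffVectorBundle ∞ V A 𝓘(ℝ, E)]
    (𝓐 : LieAlgebroid E V A) (τ : CompatibleTriple 𝓐) :
    (∀ x, IsCompl (τ.E₁ x ⊔ τ.E₂ x) (τ.L₁ x ⊔ τ.L₂ x)) ∧
    IsSmoothDistribution τ.Λ ∧
    IsIntegrableDistribution τ.Λ ∧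
    IsPoissonBracket τ.Ω.poissonBracket ∧
    ∀ {F : Type*} [NormedAddCommGroup F] [NormedSpace ℝ F] [FiniteDimensional ℝ F]
      {O : Type*} [TopologicalSpace O] [ChartedSpace F O] [IsManifold 𝓘(ℝ, F) ∞ O]
      (ι : O → M) (hι : IsIntegralSubmanifold τ.Λ ι),
      (∃! ΩO : SymplecticForm (tangentLieAlgebroid F O), IsInducedForm τ ι ΩO) ∧
      ∀ ΩO : SymplecticForm (tangentLieAlgebroid F O), IsInducedForm τ ι ΩO →
        IsPoissonBracket ΩO.poissonBracket ∧
        ∀ (f h : C^∞⟮𝓘(ℝ, E), M; ℝ⟯) (p : O),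
          τ.Ω.poissonBracket f h (ι p) =
            ΩO.poissonBracket (f.comp ⟨ι, hι.contMDiff⟩) (h.comp ⟨ι, hι.contMDiff⟩) p := by
  refine ⟨τ.isCompl_E_L, τ.isSmoothDistribution_Λ, τ.isIntegrableDistribution_Λ,
    τ.Ω.isPoissonBracket, fun {F} _ _ _ {O} _ _ _ ι hι =>
      ⟨⟨hι.inducedSymplecticForm, hι.isInducedForm_inducedSymplecticForm, fun _ hΩO =>
        hι.eq_inducedSymplecticForm hΩO⟩, fun ΩO hΩO => ⟨ΩO.isPoissonBracket, fun f h p => ?_⟩⟩⟩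
  -- By uniqueness the given form is the constructed one, whose Hamiltonian fields are known.
  obtain rfl := hι.eq_inducedSymplecticForm hΩO
  exact (hι.poissonBracket_inducedForm f h p).symm
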